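/- Work in the complex projective plane $\mathbb{P}^2(\mathbb{C})$. For a set $P$ of six points consider the property (P) the lines joining two points of $P$ are $15$ in number (equivalently, no three points of $P$ are collinear); the union of these lines has exactly six triple points (points through which exactly three of the $15$ lines pass); and the points of $P$ do not all lie on a conic. Write $P'$ for the set of triple points of the union of the lines joining two points of $P$. Then, for a generic set $P$ satisfying (P), the set $P'$ also satisfies (P); moreover, if the points of such a generic $P$ are real (i.e. lie in $\mathbb{P}^2(\mathbb{R})$), there is a unique set $P^{-}$ of six real points satisfying (P) and such that $(P^{-})' = P$. Here "generic" means: there is a finite family of six-point sets such that the statement holds for every $P$ satisfying (P) that is not projectively equivalent (over $\mathbb{C}$) to a member of the family; and the sextuples of points satisfying (P) that avoid these finitely many equivalence classes are dense among all sextuples of points satisfying (P). -/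

import Mathlib

open scoped LinearAlgebra.Projectivization

namespace SixPoints

/-- The complex projective plane. -/
abbrev Plane : Type := ℙ ℂ (Fin 3 → ℂ)

/-- Lines of the complex projective plane, given by their normals (points of the dual plane). -/
abbrev Line : Type := ℙ ℂ (Fin 3 → ℂ)

/-- The point `p` lies on the line with normal `l`: the dot product of representatives is zero. -/
def OnLine (p : Plane) (l : Line) : Prop := Projectivization.orthogonal p l

/-- The lines containing at least two points of `P`. -/
def joiningLines (P : Set Plane) : Set Line :=
  {l | 2 ≤ {p | p ∈ P ∧ OnLine p l}.encard}

/-- The points of the plane where exactly `k` lines of the arrangement `A` meet. -/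
def multiplePoints (k : ℕ) (A : Set Line) : Set Plane :=
  {x | {l | l ∈ A ∧ OnLine x l}.encard = k}

/-- The triple points of the union of the lines joining the points of `P`. -/
def triplePoints (P : Set Plane) : Set Plane := multiplePoints 3 (joiningLines P)

/-- The points of `P` all lie on some (possibly singular) conic. -/
def OnConic (P : Set Plane) : Prop :=
  ∃ Q : QuadraticForm ℂ (Fin 3 → ℂ), Q ≠ 0 ∧ ∀ p ∈ P, Q p.rep = 0

/-- Property (P): `P` consists of six points, the lines joining them are 15 in number, the union of
these lines has exactly six triple points, and the points of `P` do not lie on a conic. -/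
structure PropertyP (P : Set Plane) : Prop where
  six_points : P.encard = 6
  fifteen_lines : (joiningLines P).encard = 15
  six_triple_points : (triplePoints P).encard = 6
  not_on_conic : ¬ OnConic P

/-- `P` and `P'` are exchanged by a projective transformation of the plane. -/
def ProjEquiv (P P' : Set Plane) : Prop :=
  ∃ g : (Fin 3 → ℂ) ≃ₗ[ℂ] (Fin 3 → ℂ),
    Projectivization.map g.toLinearMap g.injective '' P = P'

/-- The point `p` of the complex plane has real homogeneous coordinates. -/
def IsReal (p : Plane) : Prop :=
  ∃ (v : Fin 3 → ℂ) (hv : v ≠ 0), (∀ i, (v i).im = 0) ∧ p = Projectivization.mk ℂ v hv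

/-- The set of the points whose homogeneous coordinates are the nonzero vectors among
`v 0, …, v 5`. -/
def pointSet (v : Fin 6 → Fin 3 → ℂ) : Set Plane :=
  {p | ∃ (i : Fin 6) (h : v i ≠ 0), p = Projectivization.mk ℂ (v i) h}

/-- `P` has property (P) and is not projectively equivalent to any member of `E`. -/
def PropertyPOutside (E : Set (Set Plane)) (P : Set Plane) : Prop :=
  PropertyP P ∧ ∀ Q ∈ E, ¬ ProjEquiv Q P

/-- The exceptional family `E` is negligible: it is finite, and the sextuples of points with
property (P) that avoid the projective equivalence classes of the members of `E` are dense among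
all sextuples of points with property (P). -/
structure IsNegligible (E : Set (Set Plane)) : Prop where
  finite : E.Finite
  dense : {v : Fin 6 → Fin 3 → ℂ | PropertyP (pointSet v)} ⊆
    closure {v : Fin 6 → Fin 3 → ℂ | PropertyPOutside E (pointSet v)}

end SixPoints

/-! When no three of the six points are collinear, a triple point is a common point of the three
lines of a syntheme, that is, of a partition of the six points into three pairs. The fifteen
synthemes correspond to the pairs of totals, a total being one of the six families of five synthemes
that use every pair once. The Joubert invariants attach a number t_i to each total so that t_i - t_j
is, up to sign, the determinant of the three lines of the syntheme common to i and j
(`concurrent_iff_joubert`). Six triple points therefore mean six coincidences t_i = t_j, and then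
the values group as 4+1+1 or 3+3 (`classification`).

In the case 4+1+1 the syntheme shared by the two remaining totals consists of three lines forming a
triangle. In the frame of this triangle the concurrences put two opposite points on each side: this
is `std α β γ`. The only modulus is k = αβγ, and property (P) amounts to k ≠ 0, k² ≠ ±1 and (k² -
1)² ≠ 16k². By `triplePoints_std` the triple points have the same form over the same triangle, with
parameters 1/(βγ), 1/(αγ), 1/(αβ), so that k becomes k⁻². Hence P' has property (P) outside finitely
many values of k. In the case 3+3 the configuration involves a primitive cube root of unity, so it
is never real, and P' is a projective image of P.

Over the reals the action on parameters can be inverted once the sign of k is absorbed in one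
parameter (`exists_real_preimage`). For uniqueness, the triangle is recovered from P: a line through
two points of P and two points of P' is one of its sides (`coordinate_of_dots`). Two real preimages
thus share the triangle, and their parameters have equal fourth powers, hence equal squares, which
determine the point set.

For density, k is moved slightly: a projective invariant built from brackets shows that only
finitely many k give a configuration with (P) equivalent to an exceptional one. -/

namespace SixPoints

/-! ### Brackets and homogeneous coordinates -/

/-- The determinant of three vectors of `ℂ³`. -/
def bracket (x y z : Fin 3 → ℂ) : ℂ :=
  x 0 * (y 1 * z 2 - y 2 * z 1) - x 1 * (y 0 * z 2 - y 2 * z 0) + x 2 * (y 0 * z 1 - y 1 * z 0)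

lemma dot_cross_eq_bracket (x y z : Fin 3 → ℂ) : x ⬝ᵥ crossProduct y z = bracket x y z := by
  rw [dotProduct, Fin.sum_univ_three]
  simp [bracket, cross_apply]
  ring

lemma bracket_map (g : (Fin 3 → ℂ) →ₗ[ℂ] (Fin 3 → ℂ)) (x y z : Fin 3 → ℂ) :
    bracket (g x) (g y) (g z) = LinearMap.det g * bracket x y z := by
  have h := Module.Basis.det_comp (Pi.basisFun ℂ (Fin 3)) g ![x, y, z]
  simp only [Pi.basisFun_det] at h
  have e : ∀ a b c : Fin 3 → ℂ, bracket a b c = Matrix.det ![a, b, c] := fun a b c => by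
    rw [← dot_cross_eq_bracket, triple_product_eq_det]
  have e' : g ∘ ![x, y, z] = ![g x, g y, g z] := by
    ext i j
    fin_cases i <;> rfl
  rw [e'] at h
  rw [e, e]
  exact h

lemma bracket_smul (a b c : ℂ) (x y z : Fin 3 → ℂ) :
    bracket (a • x) (b • y) (c • z) = a * b * c * bracket x y z := by
  simp [bracket]
  ring

lemma bracket_swap (x y z : Fin 3 → ℂ) : bracket x z y = -bracket x y z := by
  simp [bracket]
  ring

lemma bracket_rotate (x y z : Fin 3 → ℂ) : bracket y z x = bracket x y z := by
  simp [bracket]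
  ring

lemma bracket_self_left (x y : Fin 3 → ℂ) : bracket x x y = 0 := by
  simp [bracket]
  ring

lemma bracket_self_right (x y : Fin 3 → ℂ) : bracket x y y = 0 := by
  simp [bracket]
  ring

lemma bracket_self_outer (x y : Fin 3 → ℂ) : bracket x y x = 0 := by
  simp [bracket]
  ring

lemma bracket_zero (y z : Fin 3 → ℂ) : bracket 0 y z = 0 := by
  simp [bracket]

lemma cramer (a b c x : Fin 3 → ℂ) :
    bracket a b c • x = bracket x b c • a + bracket a x c • b + bracket a b x • c := by
  ext i
  fin_cases i <;> simp [bracket] <;> ring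

/-- The lines ab and ac are distinct and meet only at a; this is Cramer's rule with two vanishing
terms. -/
lemma exists_smul_of_bracket {x a b c : Fin 3 → ℂ} (h1 : bracket x a b = 0)
    (h2 : bracket x a c = 0) (h : bracket a b c ≠ 0) : ∃ t : ℂ, x = t • a := by
  refine ⟨bracket x b c / bracket a b c, ?_⟩
  have e := cramer a b c x
  have h3 : bracket a x c = 0 := by
    rw [← neg_eq_zero, ← h2]; simp [bracket]; ring
  have h4 : bracket a b x = 0 := by
    rw [← h1]; simp [bracket]; ring
  rw [h3, h4, zero_smul, zero_smul, add_zero, add_zero] at e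
  rw [div_eq_inv_mul, mul_smul, ← e, smul_smul, inv_mul_cancel₀ h, one_smul]

/-- The point with homogeneous coordinates `x` (an arbitrary point if `x = 0`). -/
noncomputable def toPoint (x : Fin 3 → ℂ) : Plane :=
  open Classical in
  if h : x ≠ 0 then Projectivization.mk ℂ x h else Projectivization.mk ℂ (fun _ => 1)
    fun e => one_ne_zero (congrFun e 0)

lemma toPoint_of_ne {x : Fin 3 → ℂ} (h : x ≠ 0) : toPoint x = Projectivization.mk ℂ x h :=
  dif_pos h

lemma toPoint_eq_iff {x y : Fin 3 → ℂ} (hx : x ≠ 0) (hy : y ≠ 0) :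
    toPoint x = toPoint y ↔ ∃ c : ℂ, c • y = x := by
  rw [toPoint_of_ne hx, toPoint_of_ne hy, Projectivization.mk_eq_mk_iff']

lemma toPoint_rep (p : Plane) : toPoint p.rep = p := by
  rw [toPoint_of_ne p.rep_nonzero, Projectivization.mk_rep]

lemma onLine_toPoint {x l : Fin 3 → ℂ} (hx : x ≠ 0) (hl : l ≠ 0) :
    OnLine (toPoint x) (toPoint l) ↔ x ⬝ᵥ l = 0 := by
  rw [toPoint_of_ne hx, toPoint_of_ne hl]
  exact Projectivization.orthogonal_mk hx hl

lemma pointSet_eq_range {v : Fin 6 → Fin 3 → ℂ} (h : ∀ i, v i ≠ 0) :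
    pointSet v = Set.range fun i => toPoint (v i) := by
  ext p
  constructor
  · rintro ⟨i, hi, rfl⟩
    exact ⟨i, toPoint_of_ne hi⟩
  · rintro ⟨i, rfl⟩
    exact ⟨i, h i, toPoint_of_ne (h i)⟩

/-! ### Six points in general position and their fifteen lines -/

/-- No three of the six vectors are linearly dependent. -/
def GenPos (u : Fin 6 → Fin 3 → ℂ) : Prop :=
  ∀ i j k, i ≠ j → i ≠ k → j ≠ k → bracket (u i) (u j) (u k) ≠ 0

lemma exists_two_others (i : Fin 6) : ∃ j k, i ≠ j ∧ i ≠ k ∧ j ≠ k := by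
  revert i; decide

lemma exists_other (i j : Fin 6) : ∃ k, i ≠ k ∧ j ≠ k := by
  revert i j; decide

lemma GenPos.ne_zero {u : Fin 6 → Fin 3 → ℂ} (h : GenPos u) (i : Fin 6) : u i ≠ 0 := by
  obtain ⟨j, k, a, b, c⟩ := exists_two_others i
  intro h0
  apply h i j k a b c
  rw [h0, bracket_zero]

lemma GenPos.not_smul {u : Fin 6 → Fin 3 → ℂ} (h : GenPos u) {i j : Fin 6} (hij : i ≠ j) (c : ℂ) :
    u i ≠ c • u j := by
  obtain ⟨k, a, b⟩ := exists_other i j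
  intro h0
  apply h i j k hij a b
  have := bracket_smul c 1 1 (u j) (u j) (u k)
  rw [one_smul, one_smul, bracket_self_left, mul_zero] at this
  rw [h0, this]

lemma GenPos.injective {u : Fin 6 → Fin 3 → ℂ} (h : GenPos u) :
    Function.Injective fun i => toPoint (u i) := by
  intro i j hij
  by_contra hne
  obtain ⟨c, hc⟩ := (toPoint_eq_iff (h.ne_zero i) (h.ne_zero j)).1 hij
  exact h.not_smul hne c hc.symm

lemma encard_range_fin {α : Type*} {n : ℕ} {f : Fin n → α} (h : Function.Injective f) :
    (Set.range f).encard = n := by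
  rw [← Set.image_univ, h.encard_image, Set.encard_univ]
  simp

lemma GenPos.encard {u : Fin 6 → Fin 3 → ℂ} (h : GenPos u) : (pointSet u).encard = 6 := by
  rw [pointSet_eq_range h.ne_zero, encard_range_fin h.injective]
  rfl

/-- The line joining two points, in homogeneous coordinates. -/
noncomputable def line (u : Fin 6 → Fin 3 → ℂ) (p : Fin 6 × Fin 6) : Line :=
  toPoint (crossProduct (u p.1) (u p.2))

/-- The pairs `(i, j)` with `i < j`. -/
def pairs : Finset (Fin 6 × Fin 6) := Finset.univ.filter fun p => p.1 < p.2

lemma mem_pairs {p : Fin 6 × Fin 6} : p ∈ pairs ↔ p.1 < p.2 := by simp [pairs]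

lemma card_pairs : pairs.card = 15 := by decide

lemma cross_ne_zero_of_bracket {x y z : Fin 3 → ℂ} (h : bracket x y z ≠ 0) :
    crossProduct y z ≠ 0 := by
  intro h0
  rw [← dot_cross_eq_bracket, h0, dotProduct_zero] at h
  exact h rfl

lemma GenPos.cross_ne_zero {u : Fin 6 → Fin 3 → ℂ} (h : GenPos u) {i j : Fin 6} (hij : i ≠ j) :
    crossProduct (u i) (u j) ≠ 0 := by
  obtain ⟨k, a, b⟩ := exists_other i j
  exact cross_ne_zero_of_bracket (h k i j a.symm b.symm hij)

lemma GenPos.onLine_line {u : Fin 6 → Fin 3 → ℂ} (h : GenPos u) {x : Fin 3 → ℂ} (hx : x ≠ 0)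
    {p : Fin 6 × Fin 6} (hp : p ∈ pairs) :
    OnLine (toPoint x) (line u p) ↔ bracket x (u p.1) (u p.2) = 0 := by
  rw [line, onLine_toPoint hx (h.cross_ne_zero (mem_pairs.1 hp).ne), dot_cross_eq_bracket]

lemma eq_toPoint_cross {a b l : Fin 3 → ℂ} (hc : crossProduct a b ≠ 0) (hl : l ≠ 0)
    (ha : a ⬝ᵥ l = 0) (hb : b ⬝ᵥ l = 0) : toPoint l = toPoint (crossProduct a b) := by
  rw [eq_comm, toPoint_of_ne hc, toPoint_of_ne hl,
    Projectivization.mk_eq_mk_iff_crossProduct_eq_zero, cross_cross_eq_smul_sub_smul, ha, hb]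
  simp

lemma GenPos.joiningLines {u : Fin 6 → Fin 3 → ℂ} (h : GenPos u) :
    joiningLines (pointSet u) = line u '' pairs := by
  have hne := h.ne_zero
  ext l
  rw [← toPoint_rep l]
  have hl := l.rep_nonzero
  generalize l.rep = l at hl
  simp only [SixPoints.joiningLines, Set.mem_ofPred_eq, Set.mem_image, Finset.mem_coe]
  rw [show (2 : ℕ∞) = 1 + 1 from rfl, ENat.add_one_le_iff (by simp), Set.one_lt_encard_iff]
  constructor
  · rintro ⟨p, q, ⟨hp, hpl⟩, ⟨hq, hql⟩, hpq⟩
    rw [pointSet_eq_range hne] at hp hq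
    obtain ⟨i, rfl⟩ := hp
    obtain ⟨j, rfl⟩ := hq
    have hij : i ≠ j := fun e => hpq (by rw [e])
    rw [onLine_toPoint (hne _) hl] at hpl hql
    rcases lt_or_gt_of_ne hij with hij | hij
    · exact ⟨(i, j), mem_pairs.2 hij, (eq_toPoint_cross (h.cross_ne_zero hij.ne) hl hpl hql).symm⟩
    · exact ⟨(j, i), mem_pairs.2 hij, (eq_toPoint_cross (h.cross_ne_zero hij.ne) hl hql hpl).symm⟩
  · rintro ⟨p, hp, hpl⟩
    rw [← hpl]
    refine ⟨toPoint (u p.1), toPoint (u p.2), ⟨?_, ?_⟩, ⟨?_, ?_⟩, ?_⟩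
    · rw [pointSet_eq_range hne]; exact ⟨_, rfl⟩
    · rw [h.onLine_line (hne _) hp, bracket_self_left]
    · rw [pointSet_eq_range hne]; exact ⟨_, rfl⟩
    · rw [h.onLine_line (hne _) hp, bracket_self_outer]
    · exact fun e => (mem_pairs.1 hp).ne (h.injective e)

lemma GenPos.third_not_on_line {u : Fin 6 → Fin 3 → ℂ} (h : GenPos u) {p : Fin 6 × Fin 6}
    (hp : p ∈ pairs) {k : Fin 6} (hk : OnLine (toPoint (u k)) (line u p)) :
    k = p.1 ∨ k = p.2 := by
  by_contra! hc
  rw [h.onLine_line (h.ne_zero k) hp] at hk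
  exact h _ _ _ hc.1 hc.2 (mem_pairs.1 hp).ne hk

/-- A joining line contains only two of the six points, so it determines its pair. -/
lemma GenPos.line_injOn {u : Fin 6 → Fin 3 → ℂ} (h : GenPos u) :
    Set.InjOn (line u) (pairs : Set (Fin 6 × Fin 6)) := by
  intro p hp q hq e
  have h1 : OnLine (toPoint (u p.1)) (line u q) := by
    rw [← e, h.onLine_line (h.ne_zero _) hp, bracket_self_left]
  have h2 : OnLine (toPoint (u p.2)) (line u q) := by
    rw [← e, h.onLine_line (h.ne_zero _) hp, bracket_self_outer]
  have h3 := h.third_not_on_line hq h1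
  have h4 := h.third_not_on_line hq h2
  have h5 := mem_pairs.1 hp
  have h6 := mem_pairs.1 hq
  ext <;> omega

lemma GenPos.encard_joiningLines {u : Fin 6 → Fin 3 → ℂ} (h : GenPos u) :
    (SixPoints.joiningLines (pointSet u)).encard = 15 := by
  rw [h.joiningLines, h.line_injOn.encard_image, Set.encard_coe_eq_coe_finsetCard, card_pairs]
  rfl

lemma exists_pointSet {P : Set Plane} (h : P.encard = 6) : ∃ u, pointSet u = P := by
  have hf : P.Finite := Set.finite_of_encard_eq_coe h
  have hc : Nat.card P = 6 := by
    rw [Nat.card_coe_set_eq, Set.ncard_def, h]; rfl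
  have := hf.to_subtype
  let e := (Finite.equivFinOfCardEq hc).symm
  refine ⟨fun i => (e i : Plane).rep, ?_⟩
  rw [pointSet_eq_range fun i => (e i : Plane).rep_nonzero]
  ext p
  simp only [toPoint_rep, Set.mem_range]
  exact ⟨fun ⟨i, hi⟩ => hi ▸ (e i).2, fun hp => ⟨e.symm ⟨p, hp⟩, by simp⟩⟩

/-- `pointSet` drops zero vectors and merges proportional ones, so six points can only come from six
nonzero, pairwise non-proportional vectors. -/
lemma ne_zero_and_injective_of_encard {u : Fin 6 → Fin 3 → ℂ} (h : (pointSet u).encard = 6) :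
    (∀ i, u i ≠ 0) ∧ Function.Injective fun i => toPoint (u i) := by
  have key : pointSet u = (fun i => toPoint (u i)) '' {i | u i ≠ 0} := by
    ext p
    constructor
    · rintro ⟨i, hi, rfl⟩
      exact ⟨i, hi, toPoint_of_ne hi⟩
    · rintro ⟨i, hi, rfl⟩
      exact ⟨i, hi, toPoint_of_ne hi⟩
  have hu : (Set.univ : Set (Fin 6)).encard = 6 := by rw [Set.encard_univ]; simp
  have h1 : {i | u i ≠ 0} = Set.univ := by
    apply Set.Finite.eq_of_subset_of_encard_le (Set.toFinite _) (Set.subset_univ _)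
    rw [hu, ← h, key]
    exact Set.encard_image_le _ _
  refine ⟨fun i => (Set.eq_univ_iff_forall.1 h1) i, ?_⟩
  rw [key, h1] at h
  rw [← Set.injOn_univ]
  exact (Set.toFinite _).injOn_of_encard_image_eq (by rw [h, hu])

lemma genPos_of_lt {u : Fin 6 → Fin 3 → ℂ}
    (hlt : ∀ i j k, i < j → j < k → bracket (u i) (u j) (u k) ≠ 0) : GenPos u := by
  intro i j k hij hik hjk h0
  have p1 : bracket (u i) (u k) (u j) = 0 := by rw [bracket_swap, h0, neg_zero]
  have p2 : bracket (u j) (u k) (u i) = 0 := by rw [bracket_rotate, h0]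
  have p3 : bracket (u k) (u i) (u j) = 0 := by rw [bracket_rotate, p2]
  have p4 : bracket (u j) (u i) (u k) = 0 := by rw [bracket_swap, p2, neg_zero]
  have p5 : bracket (u k) (u j) (u i) = 0 := by rw [bracket_swap, p3, neg_zero]
  rcases lt_or_gt_of_ne hij with a | a <;> rcases lt_or_gt_of_ne hik with b | b <;>
    rcases lt_or_gt_of_ne hjk with c | c
  · exact hlt _ _ _ a c h0
  · exact hlt _ _ _ b c p1
  · omega
  · exact hlt _ _ _ b a p3
  · exact hlt _ _ _ a b p4
  · omega
  · exact hlt _ _ _ c b p2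
  · exact hlt _ _ _ c a p5

/-- There are only fifteen candidate lines, one per pair, so fifteen lines force distinct pairs to
give distinct lines; a collinear triple i, j, k would identify the lines ij and ik. -/
lemma genPos_of_encard {u : Fin 6 → Fin 3 → ℂ} (h6 : (pointSet u).encard = 6)
    (h15 : (joiningLines (pointSet u)).encard = 15) : GenPos u := by
  obtain ⟨hne, hinj⟩ := ne_zero_and_injective_of_encard h6
  have hcr : ∀ i j, i ≠ j → crossProduct (u i) (u j) ≠ 0 := by
    intro i j hij h0
    refine hij (hinj ?_)
    simp only
    rwa [toPoint_of_ne (hne i), toPoint_of_ne (hne j),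
      Projectivization.mk_eq_mk_iff_crossProduct_eq_zero]
  have hsub : joiningLines (pointSet u) ⊆ line u '' pairs := by
    intro l
    rw [← toPoint_rep l]
    have hl := l.rep_nonzero
    generalize l.rep = l at hl
    simp only [SixPoints.joiningLines, Set.mem_ofPred_eq, Set.mem_image, Finset.mem_coe]
    rw [show (2 : ℕ∞) = 1 + 1 from rfl, ENat.add_one_le_iff (by simp), Set.one_lt_encard_iff]
    rintro ⟨p, q, ⟨hp, hpl⟩, ⟨hq, hql⟩, hpq⟩
    rw [pointSet_eq_range hne] at hp hq
    obtain ⟨i, rfl⟩ := hp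
    obtain ⟨j, rfl⟩ := hq
    have hij : i ≠ j := fun e => hpq (by rw [e])
    rw [onLine_toPoint (hne _) hl] at hpl hql
    rcases lt_or_gt_of_ne hij with hij | hij
    · exact ⟨(i, j), mem_pairs.2 hij, (eq_toPoint_cross (hcr _ _ hij.ne) hl hpl hql).symm⟩
    · exact ⟨(j, i), mem_pairs.2 hij, (eq_toPoint_cross (hcr _ _ hij.ne) hl hql hpl).symm⟩
  have hp15 : (pairs : Set (Fin 6 × Fin 6)).encard = 15 := by
    rw [Set.encard_coe_eq_coe_finsetCard, card_pairs]; rfl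
  have hI : Set.InjOn (line u) (pairs : Set (Fin 6 × Fin 6)) := by
    apply Set.Finite.injOn_of_encard_image_eq (Set.toFinite _)
    apply le_antisymm (Set.encard_image_le _ _)
    rw [hp15, ← h15]
    exact Set.encard_le_encard hsub
  refine genPos_of_lt fun i j k hij hjk h0 => ?_
  have hik := hij.trans hjk
  have e : line u (i, j) = line u (i, k) := by
    refine eq_toPoint_cross (hcr _ _ hik.ne) (hcr _ _ hij.ne) ?_ ?_
    · rw [dot_cross_eq_bracket, bracket_self_left]
    · rw [dot_cross_eq_bracket, ← h0]
      simp [bracket]; ring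
  have := hI (Finset.mem_coe.2 (mem_pairs.2 hij)) (Finset.mem_coe.2 (mem_pairs.2 hik)) e
  simp only [Prod.mk.injEq, true_and] at this
  exact hjk.ne this

/-! ### Synthemes, totals and triple points -/

/-- For `i ≠ j`, the partition of the six indices into three pairs that is common to the totals
`i` and `j`, as a fixed-point-free involution. -/
def syn : Fin 6 → Fin 6 → Fin 6 → Fin 6 :=
  ![![![0, 1, 2, 3, 4, 5], ![1, 0, 4, 5, 2, 3], ![2, 3, 0, 1, 5, 4], ![4, 5, 3, 2, 0, 1],
      ![5, 2, 1, 4, 3, 0], ![3, 4, 5, 0, 1, 2]],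
    ![![1, 0, 4, 5, 2, 3], ![0, 1, 2, 3, 4, 5], ![5, 4, 3, 2, 1, 0], ![3, 2, 1, 0, 5, 4],
      ![4, 3, 5, 1, 0, 2], ![2, 5, 0, 4, 3, 1]],
    ![![2, 3, 0, 1, 5, 4], ![5, 4, 3, 2, 1, 0], ![0, 1, 2, 3, 4, 5], ![1, 0, 5, 4, 3, 2],
      ![3, 5, 4, 0, 2, 1], ![4, 2, 1, 5, 0, 3]],
    ![![4, 5, 3, 2, 0, 1], ![3, 2, 1, 0, 5, 4], ![1, 0, 5, 4, 3, 2], ![0, 1, 2, 3, 4, 5],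
      ![2, 4, 0, 5, 1, 3], ![5, 3, 4, 1, 2, 0]],
    ![![5, 2, 1, 4, 3, 0], ![4, 3, 5, 1, 0, 2], ![3, 5, 4, 0, 2, 1], ![2, 4, 0, 5, 1, 3],
      ![0, 1, 2, 3, 4, 5], ![1, 0, 3, 2, 5, 4]],
    ![![3, 4, 5, 0, 1, 2], ![2, 5, 0, 4, 3, 1], ![4, 2, 1, 5, 0, 3], ![5, 3, 4, 1, 2, 0],
      ![1, 0, 3, 2, 5, 4], ![0, 1, 2, 3, 4, 5]]]

lemma syn_syn : ∀ i j m, syn i j (syn i j m) = m := by decide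

lemma syn_ne : ∀ i j, i < j → ∀ m, syn i j m ≠ m := by decide

lemma syn_symm : ∀ i j m, syn i j m = syn j i m := by decide

lemma exists_syn_ne : ∀ i j, i < j → ∀ i' j', i' < j' → (i = i' → j ≠ j') →
    ∃ m, syn i j m ≠ syn i' j' m := by decide

lemma card_syn_pairs : ∀ i j, i < j → (pairs.filter fun p => syn i j p.1 = p.2).card = 3 := by
  decide

lemma card_pairs_through : ∀ m, (pairs.filter fun p => m = p.1 ∨ m = p.2).card = 5 := by
  decide

/-- Two pairs without common element. -/
def Disj (p q : Fin 6 × Fin 6) : Prop := p.1 ≠ q.1 ∧ p.1 ≠ q.2 ∧ p.2 ≠ q.1 ∧ p.2 ≠ q.2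

instance (p q : Fin 6 × Fin 6) : Decidable (Disj p q) := by unfold Disj; infer_instance

-- Three disjoint pairs form a syntheme, and every syntheme is common to two totals; checked on the
-- table.
set_option maxRecDepth 10000 in
lemma exists_syn_of_disj : ∀ p ∈ pairs, ∀ q ∈ pairs, Disj p q → ∀ r ∈ pairs, Disj p r → Disj q r →
    ∃ i j, i < j ∧ ∀ m, (m, syn i j m) = p ∨ (m, syn i j m) = q ∨ (m, syn i j m) = r ∨
      (syn i j m, m) = p ∨ (syn i j m, m) = q ∨ (syn i j m, m) = r := by
  decide +kernel

/-- The vector `x` lies on the lines joining `u m` and `u (s m)`. -/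
def Through (u : Fin 6 → Fin 3 → ℂ) (s : Fin 6 → Fin 6) (x : Fin 3 → ℂ) : Prop :=
  ∀ m, bracket x (u m) (u (s m)) = 0

/-- The lines joining `u m` and `u (s m)` have a common point. -/
def Concurrent (u : Fin 6 → Fin 3 → ℂ) (s : Fin 6 → Fin 6) : Prop :=
  ∃ x ≠ 0, Through u s x

lemma exists_avoiding : ∀ m s : Fin 6, s ≠ m → ∃ k, k ≠ m ∧ k ≠ s := by decide

/-- Some line of the syntheme avoids the index m; if x were the point m, that line would contain
three of the six points. -/
lemma GenPos.not_through {u : Fin 6 → Fin 3 → ℂ} (h : GenPos u) {i j : Fin 6} (hij : i < j)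
    {x : Fin 3 → ℂ} (hx : x ≠ 0) (ht : Through u (syn i j) x) (m : Fin 6) (t : ℂ) :
    x ≠ t • u m := by
  rintro rfl
  obtain ⟨k, hk, hk'⟩ := exists_avoiding m (syn i j m) (syn_ne i j hij m)
  have h1 := ht k
  have h2 := bracket_smul t 1 1 (u m) (u k) (u (syn i j k))
  rw [one_smul, one_smul, h1] at h2
  have ht0 : t ≠ 0 := fun h0 => hx (by rw [h0, zero_smul])
  refine h m k (syn i j k) hk.symm ?_ (syn_ne i j hij k).symm ?_
  · intro e
    apply hk'
    rw [e, syn_syn]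
  · simpa [ht0] using h2.symm

/-- A second line through m and x would force x to be the point m. So a triple point determines its
syntheme, and no joining line outside the syntheme passes through it. -/
lemma GenPos.through_unique {u : Fin 6 → Fin 3 → ℂ} (h : GenPos u) {i j : Fin 6} (hij : i < j)
    {x : Fin 3 → ℂ} (hx : x ≠ 0) (ht : Through u (syn i j) x) {m n : Fin 6} (hmn : m ≠ n)
    (hb : bracket x (u m) (u n) = 0) : n = syn i j m := by
  by_contra hne
  obtain ⟨t, e⟩ := exists_smul_of_bracket (ht m) hb
    (h m _ n (syn_ne i j hij m).symm hmn (Ne.symm hne))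
  exact h.not_through hij hx ht m t e

lemma GenPos.toPoint_eq_of_through {u : Fin 6 → Fin 3 → ℂ} (h : GenPos u) {i j : Fin 6}
    (hij : i < j) {x y : Fin 3 → ℂ} (hx : x ≠ 0) (hy : y ≠ 0) (htx : Through u (syn i j) x)
    (hty : Through u (syn i j) y) : toPoint x = toPoint y := by
  obtain ⟨n, hn⟩ : ∃ n, n ≠ 0 ∧ n ≠ syn i j 0 := exists_avoiding 0 _ (syn_ne i j hij 0)
  have hl : crossProduct (u 0) (u (syn i j 0)) ≠ 0 := h.cross_ne_zero (syn_ne i j hij 0).symm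
  have hl' : crossProduct (u n) (u (syn i j n)) ≠ 0 := h.cross_ne_zero (syn_ne i j hij n).symm
  have hc : crossProduct (crossProduct (u 0) (u (syn i j 0)))
      (crossProduct (u n) (u (syn i j n))) ≠ 0 := by
    rw [ne_eq, ← Projectivization.mk_eq_mk_iff_crossProduct_eq_zero hl hl', ← toPoint_of_ne,
      ← toPoint_of_ne]
    intro e
    have : OnLine (toPoint (u n)) (toPoint (crossProduct (u 0) (u (syn i j 0)))) := by
      rw [e, onLine_toPoint (h.ne_zero _) hl', dot_cross_eq_bracket, bracket_self_left]
    rw [onLine_toPoint (h.ne_zero _) hl, dot_cross_eq_bracket] at this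
    exact h n 0 _ hn.1 hn.2 (syn_ne i j hij 0).symm this
  have key : ∀ z : Fin 3 → ℂ, z ≠ 0 → Through u (syn i j) z → toPoint z = toPoint (crossProduct
      (crossProduct (u 0) (u (syn i j 0))) (crossProduct (u n) (u (syn i j n)))) := by
    intro z hz ht
    refine eq_toPoint_cross hc hz ?_ ?_
    · rw [dotProduct_comm, dot_cross_eq_bracket]; exact ht 0
    · rw [dotProduct_comm, dot_cross_eq_bracket]; exact ht n
  rw [key x hx htx, key y hy hty]

/-- Each of the six points lies on five joining lines, so it is not triple. At any other point, two
distinct joining lines have disjoint pairs, so three of them make up a syntheme; conversely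
`through_unique` excludes a fourth line. -/
lemma GenPos.mem_triplePoints {u : Fin 6 → Fin 3 → ℂ} (h : GenPos u) {x : Fin 3 → ℂ}
    (hx : x ≠ 0) :
    toPoint x ∈ triplePoints (pointSet u) ↔ ∃ i j, i < j ∧ Through u (syn i j) x := by
  classical
  have hN : {l | l ∈ SixPoints.joiningLines (pointSet u) ∧ OnLine (toPoint x) l} =
      line u '' ((pairs.filter fun p => bracket x (u p.1) (u p.2) = 0 : Finset _) : Set _) := by
    rw [h.joiningLines]
    ext l
    constructor
    · rintro ⟨⟨p, hp, rfl⟩, hl⟩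
      rw [h.onLine_line hx hp] at hl
      exact ⟨p, by simpa using ⟨hp, hl⟩, rfl⟩
    · rintro ⟨p, hp, rfl⟩
      simp only [Finset.coe_filter, Set.mem_ofPred_eq] at hp
      exact ⟨⟨p, hp.1, rfl⟩, (h.onLine_line hx hp.1).2 hp.2⟩
  have hcard : toPoint x ∈ triplePoints (pointSet u) ↔
      (pairs.filter fun p => bracket x (u p.1) (u p.2) = 0).card = 3 := by
    simp only [triplePoints, multiplePoints, Set.mem_ofPred_eq]
    rw [hN, Set.InjOn.encard_image, Set.encard_coe_eq_coe_finsetCard]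
    · exact Nat.cast_inj
    · exact h.line_injOn.mono (Finset.coe_subset.2 (Finset.filter_subset _ _))
  rw [hcard]
  constructor
  · intro hc
    by_cases hm : ∃ (m : Fin 6) (t : ℂ), x = t • u m
    · exfalso
      obtain ⟨m, t, rfl⟩ := hm
      have := Finset.card_le_card (s := pairs.filter fun p => m = p.1 ∨ m = p.2)
        (t := pairs.filter fun p => bracket (t • u m) (u p.1) (u p.2) = 0) (by
          intro p hp
          simp only [Finset.mem_filter] at hp ⊢
          refine ⟨hp.1, ?_⟩
          have e := bracket_smul t 1 1 (u m) (u p.1) (u p.2)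
          rw [one_smul, one_smul] at e
          rw [e]
          rcases hp.2 with e | e
          · rw [← e, bracket_self_left, mul_zero]
          · rw [← e, bracket_self_outer, mul_zero])
      rw [card_pairs_through, hc] at this
      omega
    · push Not at hm
      have key : ∀ a b c, b ≠ c → a ≠ b → a ≠ c → bracket x (u a) (u b) = 0 →
          bracket x (u a) (u c) ≠ 0 := by
        intro a b c hbc hab hac h1 h2
        obtain ⟨t, ht⟩ := exists_smul_of_bracket h1 h2 (h a b c hab hac hbc)
        exact hm a t ht
      have key' : ∀ p q : Fin 6 × Fin 6, p ∈ pairs → q ∈ pairs → p ≠ q →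
          bracket x (u p.1) (u p.2) = 0 → bracket x (u q.1) (u q.2) = 0 → Disj p q := by
        rintro ⟨a, b⟩ ⟨c, d⟩ hp hq hpq h1 h2
        rw [mem_pairs] at hp hq
        simp only at hp hq h1 h2
        have h1' : bracket x (u b) (u a) = 0 := by rw [bracket_swap, h1, neg_zero]
        have h2' : bracket x (u d) (u c) = 0 := by rw [bracket_swap, h2, neg_zero]
        refine ⟨?_, ?_, ?_, ?_⟩ <;> rintro e <;> simp only at e <;> subst e
        · exact key a b d (by rintro rfl; exact hpq rfl) hp.ne hq.ne h1 h2
        · exact key a b c (by omega) hp.ne hq.ne' h1 h2'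
        · exact key b a d (by omega) hp.ne' hq.ne h1' h2
        · exact key b a c (by rintro rfl; exact hpq rfl) hp.ne' hq.ne' h1' h2'
      obtain ⟨p, q, r, hpq, hpr, hqr, e⟩ := Finset.card_eq_three.1 hc
      have hp : p ∈ pairs ∧ bracket x (u p.1) (u p.2) = 0 := by
        have := Finset.ext_iff.1 e p
        simpa using this
      have hq : q ∈ pairs ∧ bracket x (u q.1) (u q.2) = 0 := by
        have := Finset.ext_iff.1 e q
        simpa using this
      have hr : r ∈ pairs ∧ bracket x (u r.1) (u r.2) = 0 := by
        have := Finset.ext_iff.1 e r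
        simpa using this
      obtain ⟨i, j, hij, hs⟩ := exists_syn_of_disj p hp.1 q hq.1
        (key' p q hp.1 hq.1 hpq hp.2 hq.2) r hr.1 (key' p r hp.1 hr.1 hpr hp.2 hr.2)
        (key' q r hq.1 hr.1 hqr hq.2 hr.2)
      refine ⟨i, j, hij, fun m => ?_⟩
      rcases hs m with e | e | e | e | e | e
      · rw [← e] at hp; exact hp.2
      · rw [← e] at hq; exact hq.2
      · rw [← e] at hr; exact hr.2
      · rw [← e] at hp; rw [bracket_swap, hp.2, neg_zero]
      · rw [← e] at hq; rw [bracket_swap, hq.2, neg_zero]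
      · rw [← e] at hr; rw [bracket_swap, hr.2, neg_zero]
  · rintro ⟨i, j, hij, ht⟩
    rw [← card_syn_pairs i j hij]
    congr 1
    ext p
    simp only [Finset.mem_filter, and_congr_right_iff]
    intro hp
    constructor
    · exact fun hb => (h.through_unique hij hx ht (mem_pairs.1 hp).ne hb).symm
    · intro e
      rw [← e]
      exact ht _

/-- Concurrent synthemes and triple points correspond bijectively, a point determining its syntheme
and a syntheme its point. -/
lemma GenPos.encard_triplePoints {u : Fin 6 → Fin 3 → ℂ} (h : GenPos u)
    [DecidablePred fun p : Fin 6 × Fin 6 => Concurrent u (syn p.1 p.2)] :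
    (triplePoints (pointSet u)).encard =
      (pairs.filter fun p => Concurrent u (syn p.1 p.2)).card := by
  have hch : ∀ p : Fin 6 × Fin 6, ∃ x : Fin 3 → ℂ, x ≠ 0 ∧
      (Concurrent u (syn p.1 p.2) → Through u (syn p.1 p.2) x) := by
    intro p
    by_cases hp : Concurrent u (syn p.1 p.2)
    · obtain ⟨x, hx, h⟩ := hp
      exact ⟨x, hx, fun _ => h⟩
    · exact ⟨u 0, h.ne_zero 0, fun e => (hp e).elim⟩
  choose f hf0 hf using hch
  have hinj : Set.InjOn (fun p => toPoint (f p))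
      ((pairs.filter fun p => Concurrent u (syn p.1 p.2) : Finset _) : Set (Fin 6 × Fin 6)) := by
    intro p hp q hq e
    simp only [Finset.coe_filter, Set.mem_ofPred_eq, mem_pairs] at hp hq
    obtain ⟨c, hc⟩ := (toPoint_eq_iff (hf0 p) (hf0 q)).1 e
    by_contra hpq
    obtain ⟨m, hm⟩ := exists_syn_ne p.1 p.2 hp.1 q.1 q.2 hq.1
      (fun e1 e2 => hpq (Prod.ext e1 e2))
    apply hm
    rw [eq_comm]
    refine h.through_unique hp.1 (hf0 p) (hf p hp.2) (syn_ne _ _ hq.1 m).symm ?_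
    have := bracket_smul c 1 1 (f q) (u m) (u (syn q.1 q.2 m))
    rwa [hf q hq.2 m, mul_zero, one_smul, one_smul, hc] at this
  rw [← Set.encard_coe_eq_coe_finsetCard, ← hinj.encard_image]
  congr 1
  ext y
  rw [← toPoint_rep y]
  have hy := y.rep_nonzero
  generalize y.rep = y at hy
  rw [h.mem_triplePoints hy]
  constructor
  · rintro ⟨i, j, hij, ht⟩
    refine ⟨(i, j), by simpa [mem_pairs, hij] using ⟨y, hy, ht⟩, ?_⟩
    exact h.toPoint_eq_of_through hij (hf0 (i, j)) hy (hf (i, j) ⟨y, hy, ht⟩) ht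
  · rintro ⟨p, hp, e⟩
    simp only [Finset.coe_filter, Set.mem_ofPred_eq, mem_pairs] at hp
    rw [← h.mem_triplePoints hy, ← e, h.mem_triplePoints (hf0 p)]
    exact ⟨p.1, p.2, hp.1, hf p hp.2⟩

/-! ### Joubert invariants -/

/-- The determinant of the lines `ab`, `cd` and `ef`; it vanishes when they are concurrent. -/
def conc (a b c d e f : Fin 3 → ℂ) : ℂ :=
  bracket a c d * bracket b e f - bracket b c d * bracket a e f

lemma exists_common_iff (a b c d e f : Fin 3 → ℂ) :
    (∃ x ≠ 0, bracket x a b = 0 ∧ bracket x c d = 0 ∧ bracket x e f = 0) ↔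
      conc a b c d e f = 0 := by
  have h := Matrix.exists_mulVec_eq_zero_iff
    (M := Matrix.of ![crossProduct a b, crossProduct c d, crossProduct e f])
  have hd : (Matrix.of ![crossProduct a b, crossProduct c d, crossProduct e f]).det =
      conc a b c d e f := by
    simp [Matrix.det_fin_three, conc, bracket, cross_apply]
    ring
  rw [hd] at h
  rw [← h]
  refine exists_congr fun x => and_congr_right fun _ => ?_
  rw [funext_iff, Fin.forall_fin_succ, Fin.forall_fin_two]
  simp only [Matrix.mulVec, Matrix.of_apply, ← dot_cross_eq_bracket, Pi.zero_apply]
  rw [dotProduct_comm x, dotProduct_comm x, dotProduct_comm x]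
  rfl

lemma concurrent_iff (u : Fin 6 → Fin 3 → ℂ) (s : Fin 6 → Fin 6) (a b c d e f : Fin 6)
    (h1 : s a = b ∧ s b = a) (h2 : s c = d ∧ s d = c) (h3 : s e = f ∧ s f = e)
    (hm : ∀ m, m = a ∨ m = b ∨ m = c ∨ m = d ∨ m = e ∨ m = f) :
    Concurrent u s ↔ conc (u a) (u b) (u c) (u d) (u e) (u f) = 0 := by
  rw [← exists_common_iff]
  refine exists_congr fun x => and_congr_right fun _ => ⟨fun h => ?_, fun ⟨p, q, r⟩ m => ?_⟩
  · refine ⟨?_, ?_, ?_⟩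
    · rw [← h1.1]; exact h a
    · rw [← h2.1]; exact h c
    · rw [← h3.1]; exact h e
  · rcases hm m with rfl | rfl | rfl | rfl | rfl | rfl
    · rw [h1.1, p]
    · rw [h1.2, bracket_swap, p, neg_zero]
    · rw [h2.1, q]
    · rw [h2.2, bracket_swap, q, neg_zero]
    · rw [h3.1, r]
    · rw [h3.2, bracket_swap, r, neg_zero]

/-- The invariants of Joubert and Coble of six vectors, up to a common additive constant. -/
def joubert (u : Fin 6 → Fin 3 → ℂ) : Fin 6 → ℂ :=
  ![0,
    conc (u 0) (u 1) (u 2) (u 4) (u 3) (u 5),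
    conc (u 0) (u 2) (u 1) (u 3) (u 4) (u 5),
    conc (u 0) (u 4) (u 1) (u 5) (u 2) (u 3),
    conc (u 0) (u 5) (u 1) (u 2) (u 3) (u 4),
    -conc (u 0) (u 3) (u 1) (u 4) (u 2) (u 5)]

/-- The invariant of total 0 is normalized to 0, so for pairs containing 0 the determinant is, up to
sign, the other invariant by definition. -/
lemma concurrent_iff_joubert_0_1 (u : Fin 6 → Fin 3 → ℂ) :
    Concurrent u (syn 0 1) ↔ joubert u 0 = joubert u 1 := by
  rw [concurrent_iff u _ 0 1 2 4 3 5 (by decide) (by decide) (by decide) (by decide),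
    show conc (u 0) (u 1) (u 2) (u 4) (u 3) (u 5) =
      joubert u 1 - joubert u 0 by
        simp [joubert, conc, bracket], sub_eq_zero, eq_comm]

lemma concurrent_iff_joubert_0_2 (u : Fin 6 → Fin 3 → ℂ) :
    Concurrent u (syn 0 2) ↔ joubert u 0 = joubert u 2 := by
  rw [concurrent_iff u _ 0 2 1 3 4 5 (by decide) (by decide) (by decide) (by decide),
    show conc (u 0) (u 2) (u 1) (u 3) (u 4) (u 5) =
      joubert u 2 - joubert u 0 by
        simp [joubert, conc, bracket], sub_eq_zero, eq_comm]

lemma concurrent_iff_joubert_0_3 (u : Fin 6 → Fin 3 → ℂ) :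
    Concurrent u (syn 0 3) ↔ joubert u 0 = joubert u 3 := by
  rw [concurrent_iff u _ 0 4 1 5 2 3 (by decide) (by decide) (by decide) (by decide),
    show conc (u 0) (u 4) (u 1) (u 5) (u 2) (u 3) =
      joubert u 3 - joubert u 0 by
        simp [joubert, conc, bracket], sub_eq_zero, eq_comm]

lemma concurrent_iff_joubert_0_4 (u : Fin 6 → Fin 3 → ℂ) :
    Concurrent u (syn 0 4) ↔ joubert u 0 = joubert u 4 := by
  rw [concurrent_iff u _ 0 5 1 2 3 4 (by decide) (by decide) (by decide) (by decide),
    show conc (u 0) (u 5) (u 1) (u 2) (u 3) (u 4) =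
      joubert u 4 - joubert u 0 by
        simp [joubert, conc, bracket], sub_eq_zero, eq_comm]

lemma concurrent_iff_joubert_0_5 (u : Fin 6 → Fin 3 → ℂ) :
    Concurrent u (syn 0 5) ↔ joubert u 0 = joubert u 5 := by
  rw [concurrent_iff u _ 0 3 1 4 2 5 (by decide) (by decide) (by decide) (by decide),
    show conc (u 0) (u 3) (u 1) (u 4) (u 2) (u 5) =
      joubert u 0 - joubert u 5 by
        simp [joubert, conc, bracket], sub_eq_zero]

/-- Here and for the pairs below, the determinant of the common syntheme equals the difference of
the two invariants up to sign, as a polynomial identity in the coordinates. -/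
lemma concurrent_iff_joubert_1_2 (u : Fin 6 → Fin 3 → ℂ) :
    Concurrent u (syn 1 2) ↔ joubert u 1 = joubert u 2 := by
  rw [concurrent_iff u _ 0 5 1 4 2 3 (by decide) (by decide) (by decide) (by decide),
    show conc (u 0) (u 5) (u 1) (u 4) (u 2) (u 3) =
      joubert u 1 - joubert u 2 by
        simp [joubert, conc, bracket]
        ring, sub_eq_zero]

lemma concurrent_iff_joubert_1_3 (u : Fin 6 → Fin 3 → ℂ) :
    Concurrent u (syn 1 3) ↔ joubert u 1 = joubert u 3 := by
  rw [concurrent_iff u _ 0 3 1 2 4 5 (by decide) (by decide) (by decide) (by decide),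
    show conc (u 0) (u 3) (u 1) (u 2) (u 4) (u 5) =
      joubert u 1 - joubert u 3 by
        simp [joubert, conc, bracket]
        ring, sub_eq_zero]

lemma concurrent_iff_joubert_1_4 (u : Fin 6 → Fin 3 → ℂ) :
    Concurrent u (syn 1 4) ↔ joubert u 1 = joubert u 4 := by
  rw [concurrent_iff u _ 0 4 1 3 2 5 (by decide) (by decide) (by decide) (by decide),
    show conc (u 0) (u 4) (u 1) (u 3) (u 2) (u 5) =
      joubert u 4 - joubert u 1 by
        simp [joubert, conc, bracket]
        ring, sub_eq_zero, eq_comm]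

lemma concurrent_iff_joubert_1_5 (u : Fin 6 → Fin 3 → ℂ) :
    Concurrent u (syn 1 5) ↔ joubert u 1 = joubert u 5 := by
  rw [concurrent_iff u _ 0 2 1 5 3 4 (by decide) (by decide) (by decide) (by decide),
    show conc (u 0) (u 2) (u 1) (u 5) (u 3) (u 4) =
      joubert u 1 - joubert u 5 by
        simp [joubert, conc, bracket]
        ring, sub_eq_zero]

lemma concurrent_iff_joubert_2_3 (u : Fin 6 → Fin 3 → ℂ) :
    Concurrent u (syn 2 3) ↔ joubert u 2 = joubert u 3 := by
  rw [concurrent_iff u _ 0 1 2 5 3 4 (by decide) (by decide) (by decide) (by decide),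
    show conc (u 0) (u 1) (u 2) (u 5) (u 3) (u 4) =
      joubert u 3 - joubert u 2 by
        simp [joubert, conc, bracket]
        ring, sub_eq_zero, eq_comm]

lemma concurrent_iff_joubert_2_4 (u : Fin 6 → Fin 3 → ℂ) :
    Concurrent u (syn 2 4) ↔ joubert u 2 = joubert u 4 := by
  rw [concurrent_iff u _ 0 3 1 5 2 4 (by decide) (by decide) (by decide) (by decide),
    show conc (u 0) (u 3) (u 1) (u 5) (u 2) (u 4) =
      joubert u 2 - joubert u 4 by
        simp [joubert, conc, bracket]
        ring, sub_eq_zero]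

lemma concurrent_iff_joubert_2_5 (u : Fin 6 → Fin 3 → ℂ) :
    Concurrent u (syn 2 5) ↔ joubert u 2 = joubert u 5 := by
  rw [concurrent_iff u _ 0 4 1 2 3 5 (by decide) (by decide) (by decide) (by decide),
    show conc (u 0) (u 4) (u 1) (u 2) (u 3) (u 5) =
      joubert u 5 - joubert u 2 by
        simp [joubert, conc, bracket]
        ring, sub_eq_zero, eq_comm]

lemma concurrent_iff_joubert_3_4 (u : Fin 6 → Fin 3 → ℂ) :
    Concurrent u (syn 3 4) ↔ joubert u 3 = joubert u 4 := by
  rw [concurrent_iff u _ 0 2 1 4 3 5 (by decide) (by decide) (by decide) (by decide),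
    show conc (u 0) (u 2) (u 1) (u 4) (u 3) (u 5) =
      joubert u 3 - joubert u 4 by
        simp [joubert, conc, bracket]
        ring, sub_eq_zero]

lemma concurrent_iff_joubert_3_5 (u : Fin 6 → Fin 3 → ℂ) :
    Concurrent u (syn 3 5) ↔ joubert u 3 = joubert u 5 := by
  rw [concurrent_iff u _ 0 5 1 3 2 4 (by decide) (by decide) (by decide) (by decide),
    show conc (u 0) (u 5) (u 1) (u 3) (u 2) (u 4) =
      joubert u 5 - joubert u 3 by
        simp [joubert, conc, bracket]
        ring, sub_eq_zero, eq_comm]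

lemma concurrent_iff_joubert_4_5 (u : Fin 6 → Fin 3 → ℂ) :
    Concurrent u (syn 4 5) ↔ joubert u 4 = joubert u 5 := by
  rw [concurrent_iff u _ 0 1 2 3 4 5 (by decide) (by decide) (by decide) (by decide),
    show conc (u 0) (u 1) (u 2) (u 3) (u 4) (u 5) =
      joubert u 5 - joubert u 4 by
        simp [joubert, conc, bracket]
        ring, sub_eq_zero, eq_comm]

lemma concurrent_iff_joubert (u : Fin 6 → Fin 3 → ℂ) (i j : Fin 6) :
    Concurrent u (syn i j) ↔ joubert u i = joubert u j := by
  have key : ∀ i j : Fin 6, i < j → (Concurrent u (syn i j) ↔ joubert u i = joubert u j) := by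
    intro i j hij
    fin_cases i <;> fin_cases j <;> first | exact absurd hij (by decide) | skip
    · exact concurrent_iff_joubert_0_1 u
    · exact concurrent_iff_joubert_0_2 u
    · exact concurrent_iff_joubert_0_3 u
    · exact concurrent_iff_joubert_0_4 u
    · exact concurrent_iff_joubert_0_5 u
    · exact concurrent_iff_joubert_1_2 u
    · exact concurrent_iff_joubert_1_3 u
    · exact concurrent_iff_joubert_1_4 u
    · exact concurrent_iff_joubert_1_5 u
    · exact concurrent_iff_joubert_2_3 u
    · exact concurrent_iff_joubert_2_4 u
    · exact concurrent_iff_joubert_2_5 u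
    · exact concurrent_iff_joubert_3_4 u
    · exact concurrent_iff_joubert_3_5 u
    · exact concurrent_iff_joubert_4_5 u
  rcases lt_trichotomy i j with h | rfl | h
  · exact key i j h
  -- On the diagonal the table holds the identity, so every bracket has a repeated entry and any
  -- nonzero vector serves.
  · refine ⟨fun _ => rfl, fun _ => ⟨fun _ => 1, fun e => one_ne_zero (congrFun e 0), fun m => ?_⟩⟩
    rw [(by decide : ∀ i m, syn i i m = m) i m, bracket_self_right]
  · rw [show syn i j = syn j i from funext (syn_symm i j), key j i h, eq_comm]

/-! ### Invariance under projective maps, rescaling and relabeling -/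

section Invariance

variable (g : (Fin 3 → ℂ) ≃ₗ[ℂ] (Fin 3 → ℂ)) (u : Fin 6 → Fin 3 → ℂ)

lemma bracket_equiv_eq_zero_iff (x y z : Fin 3 → ℂ) :
    bracket (g x) (g y) (g z) = 0 ↔ bracket x y z = 0 := by
  have := bracket_map g.toLinearMap x y z
  simp only [LinearEquiv.coe_coe] at this
  rw [this, mul_eq_zero, or_iff_right (LinearEquiv.isUnit_det' g).ne_zero]

lemma genPos_map : GenPos (fun i => g (u i)) ↔ GenPos u := by
  simp only [GenPos, ne_eq, bracket_equiv_eq_zero_iff]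

lemma through_map (s : Fin 6 → Fin 6) (x : Fin 3 → ℂ) :
    Through (fun i => g (u i)) s (g x) ↔ Through u s x := by
  simp only [Through, bracket_equiv_eq_zero_iff]

lemma concurrent_map (s : Fin 6 → Fin 6) :
    Concurrent (fun i => g (u i)) s ↔ Concurrent u s := by
  constructor
  · rintro ⟨x, hx, h⟩
    obtain ⟨y, rfl⟩ := g.surjective x
    exact ⟨y, fun e => hx (by rw [e, map_zero]), (through_map g u s y).1 h⟩
  · rintro ⟨x, hx, h⟩
    exact ⟨g x, fun e => hx (g.map_eq_zero_iff.1 e), (through_map g u s x).2 h⟩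

lemma pointSet_map :
    pointSet (fun i => g (u i)) =
      Projectivization.map g.toLinearMap g.injective '' pointSet u := by
  ext p
  constructor
  · rintro ⟨i, hi, rfl⟩
    have h0 : u i ≠ 0 := fun e => hi (by simp only [e, map_zero])
    exact ⟨_, ⟨i, h0, rfl⟩, Projectivization.map_mk _ _ _ _⟩
  · rintro ⟨_, ⟨i, hi, rfl⟩, rfl⟩
    exact ⟨i, fun e => hi (g.map_eq_zero_iff.1 e), Projectivization.map_mk _ _ _ _⟩

end Invariance

lemma pointSet_eq_of_smul {u w : Fin 6 → Fin 3 → ℂ} {l : Fin 6 → Fin 6} {c : Fin 6 → ℂ}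
    (hl : Function.Surjective l) (hc : ∀ i, c i ≠ 0) (h : ∀ i, u i = c i • w (l i)) :
    pointSet u = pointSet w := by
  ext p
  constructor
  · rintro ⟨i, hi, rfl⟩
    have h0 : w (l i) ≠ 0 := fun e => hi (by rw [h, e, smul_zero])
    exact ⟨l i, h0, (Projectivization.mk_eq_mk_iff' _ _ _ _ _).2 ⟨c i, (h i).symm⟩⟩
  · rintro ⟨i, hi, rfl⟩
    obtain ⟨i, rfl⟩ := hl i
    have h0 : u i ≠ 0 := by rw [h]; exact smul_ne_zero (hc i) hi
    refine ⟨i, h0, (Projectivization.mk_eq_mk_iff' _ _ _ _ _).2 ⟨(c i)⁻¹, ?_⟩⟩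
    rw [h, smul_smul, inv_mul_cancel₀ (hc i), one_smul]

lemma pointSet_comp {u : Fin 6 → Fin 3 → ℂ} {l : Fin 6 → Fin 6} (hl : Function.Surjective l) :
    pointSet (fun i => u (l i)) = pointSet u :=
  pointSet_eq_of_smul hl (c := fun _ => 1) (fun _ => one_ne_zero) fun i => by rw [one_smul]

lemma exists_smul_of_pointSet_eq {u w : Fin 6 → Fin 3 → ℂ} (hu : GenPos u) (hw : GenPos w)
    (h : pointSet u = pointSet w) :
    ∃ (l : Equiv.Perm (Fin 6)) (c : Fin 6 → ℂ), (∀ i, c i ≠ 0) ∧ ∀ i, u i = c i • w (l i) := by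
  have key : ∀ i, ∃ j, ∃ c : ℂ, c ≠ 0 ∧ u i = c • w j := by
    intro i
    have hi : toPoint (u i) ∈ pointSet w := by
      rw [← h, pointSet_eq_range hu.ne_zero]; exact ⟨i, rfl⟩
    rw [pointSet_eq_range hw.ne_zero] at hi
    obtain ⟨j, hj⟩ := hi
    obtain ⟨c, hc⟩ := (toPoint_eq_iff (hu.ne_zero i) (hw.ne_zero j)).1 hj.symm
    refine ⟨j, c, ?_, hc.symm⟩
    rintro rfl
    exact hu.ne_zero i (by rw [← hc, zero_smul])
  choose l c hc0 hc using key
  have hl : Function.Injective l := by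
    intro i j hij
    by_contra hne
    apply hu.not_smul hne (c i * (c j)⁻¹)
    rw [hc i, hc j, hij, smul_smul, mul_assoc, inv_mul_cancel₀ (hc0 j), mul_one]
  exact ⟨Equiv.ofBijective l (Finite.injective_iff_bijective.1 hl), c, hc0, hc⟩

/-! ### Property (P) in terms of six vectors -/

open Classical in
/-- The number of triples of lines joining the six points in pairs that are concurrent. -/
noncomputable def coincidences (t : Fin 6 → ℂ) : ℕ :=
  (pairs.filter fun p => t p.1 = t p.2).card

lemma onConic_pointSet {u : Fin 6 → Fin 3 → ℂ} (h : ∀ i, u i ≠ 0) :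
    OnConic (pointSet u) ↔ ∃ Q : QuadraticForm ℂ (Fin 3 → ℂ), Q ≠ 0 ∧ ∀ i, Q (u i) = 0 := by
  refine exists_congr fun Q => and_congr_right fun _ => ?_
  have key : ∀ i, Q (toPoint (u i)).rep = 0 ↔ Q (u i) = 0 := by
    intro i
    obtain ⟨c, hc⟩ := (toPoint_eq_iff (h i) (toPoint (u i)).rep_nonzero).1
      (toPoint_rep (toPoint (u i))).symm
    have hc0 : c ≠ 0 := by
      rintro rfl
      exact h i (by rw [← hc, zero_smul])
    rw [← hc, QuadraticMap.map_smul, hc]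
    simp [hc0]
  rw [pointSet_eq_range h]
  constructor
  · exact fun hQ i => (key i).1 (hQ _ ⟨i, rfl⟩)
  · rintro hQ _ ⟨i, rfl⟩
    exact (key i).2 (hQ i)

/-- Cardinality six and fifteen lines together amount to general position, and triple points are
counted by coincidences of Joubert invariants. -/
lemma propertyP_pointSet_iff {u : Fin 6 → Fin 3 → ℂ} :
    PropertyP (pointSet u) ↔ GenPos u ∧ coincidences (joubert u) = 6 ∧
      ¬ ∃ Q : QuadraticForm ℂ (Fin 3 → ℂ), Q ≠ 0 ∧ ∀ i, Q (u i) = 0 := by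
  classical
  have key : ∀ h : GenPos u, (triplePoints (pointSet u)).encard = 6 ↔
      coincidences (joubert u) = 6 := by
    intro h
    rw [h.encard_triplePoints, coincidences]
    simp only [concurrent_iff_joubert]
    norm_cast
  constructor
  · intro hP
    have h := genPos_of_encard hP.six_points hP.fifteen_lines
    refine ⟨h, (key h).1 hP.six_triple_points, ?_⟩
    rw [← onConic_pointSet h.ne_zero]
    exact hP.not_on_conic
  · rintro ⟨h, h6, hQ⟩
    rw [← onConic_pointSet h.ne_zero] at hQ
    exact ⟨h.encard, h.encard_joiningLines, (key h).2 h6, hQ⟩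

lemma propertyP_map (g : (Fin 3 → ℂ) ≃ₗ[ℂ] (Fin 3 → ℂ)) {u : Fin 6 → Fin 3 → ℂ} :
    PropertyP (pointSet fun i => g (u i)) ↔ PropertyP (pointSet u) := by
  classical
  rw [propertyP_pointSet_iff, propertyP_pointSet_iff, genPos_map]
  refine and_congr_right fun _ => and_congr ?_ (not_congr ?_)
  · simp only [coincidences, ← concurrent_iff_joubert, concurrent_map]
  · constructor
    · rintro ⟨Q, hQ, h⟩
      refine ⟨Q.comp g.toLinearMap, fun e => hQ ?_, fun i => by simpa using h i⟩
      ext x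
      have := congrArg (fun q : QuadraticForm ℂ (Fin 3 → ℂ) => q (g.symm x)) e
      simpa using this
    · rintro ⟨Q, hQ, h⟩
      refine ⟨Q.comp g.symm.toLinearMap, fun e => hQ ?_, fun i => by simpa using h i⟩
      ext x
      have := congrArg (fun q : QuadraticForm ℂ (Fin 3 → ℂ) => q (g x)) e
      simpa using this

lemma triplePoints_eq {u w : Fin 6 → Fin 3 → ℂ} (hu : PropertyP (pointSet u)) (hw : GenPos w)
    (h : ∀ m, ∃ i j, i < j ∧ Through u (syn i j) (w m)) :
    triplePoints (pointSet u) = pointSet w := by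
  have hg := (propertyP_pointSet_iff.1 hu).1
  symm
  apply Set.Finite.eq_of_subset_of_encard_le
  · exact Set.finite_of_encard_eq_coe hw.encard
  · rw [pointSet_eq_range hw.ne_zero]
    rintro _ ⟨m, rfl⟩
    rw [hg.mem_triplePoints (hw.ne_zero m)]
    exact h m
  · rw [hu.six_triple_points, hw.encard]

/-! ### The two coincidence patterns and the relabelings -/

/-- Six coincidences among the values of a function on six elements: they come from a value taken
four times, or from two values taken three times each. -/
lemma classification {t : Fin 6 → ℂ} (h : coincidences t = 6) :
    (∃ a b, a ≠ b ∧ t a ≠ t b ∧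
      ∀ i j, i ≠ a → i ≠ b → j ≠ a → j ≠ b → t i = t j) ∨
    ∃ B : Finset (Fin 6), B.card = 3 ∧ ∀ i j, (i ∈ B ↔ j ∈ B) → t i = t j := by
  classical
  let C : Fin 6 → Finset (Fin 6) := fun i => Finset.univ.filter fun j => t i = t j
  have hself : ∀ i, i ∈ C i := fun i => by simp [C]
  -- The sum counts ordered pairs with equal values: twice the six coincidences, plus the six
  -- diagonal pairs.
  have hcount : ∑ i, (C i).card = 18 := by
    have h1 : ∑ i, (C i).card =
        ((Finset.univ : Finset (Fin 6 × Fin 6)).filter fun p => t p.1 = t p.2).card := by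
      simp only [C, Finset.card_filter]
      rw [← Finset.univ_product_univ, Finset.sum_product]
    have h2 : ((Finset.univ : Finset (Fin 6 × Fin 6)).filter fun p => t p.1 = t p.2) =
        (pairs.filter fun p => t p.1 = t p.2) ∪ ((pairs.filter fun p => t p.1 = t p.2).image
          Prod.swap ∪ Finset.univ.image fun i => (i, i)) := by
      ext ⟨i, j⟩
      simp only [Finset.mem_filter, Finset.mem_univ, true_and, Finset.mem_union, Finset.mem_image,
        mem_pairs, Prod.exists, Prod.swap_prod_mk, Prod.mk.injEq]
      constructor
      · intro e
        rcases lt_trichotomy i j with hij | hij | hij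
        · exact Or.inl ⟨hij, e⟩
        · exact Or.inr (Or.inr ⟨i, rfl, hij⟩)
        · exact Or.inr (Or.inl ⟨j, i, ⟨hij, e.symm⟩, rfl, rfl⟩)
      · rintro (⟨_, e⟩ | ⟨a, b, ⟨_, e⟩, rfl, rfl⟩ | ⟨a, rfl, rfl⟩)
        · exact e
        · exact e.symm
        · rfl
    have h6 : (pairs.filter fun p => t p.1 = t p.2).card = 6 := by
      exact h
    rw [h1, h2, Finset.card_union_of_disjoint, Finset.card_union_of_disjoint,
      Finset.card_image_of_injective _ Prod.swap_injective,
      Finset.card_image_of_injective _ (fun a b e => (Prod.mk.inj e).1), h6]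
    · rfl
    · rw [Finset.disjoint_left]
      rintro ⟨i, j⟩ hp hq
      simp only [Finset.mem_filter, Finset.mem_univ, true_and, Finset.mem_image, mem_pairs,
        Prod.exists, Prod.swap_prod_mk, Prod.mk.injEq] at hp hq
      omega
    · rw [Finset.disjoint_left]
      rintro ⟨i, j⟩ hp hq
      simp only [Finset.mem_filter, Finset.mem_univ, true_and, Finset.mem_union, Finset.mem_image,
        mem_pairs, Prod.exists, Prod.swap_prod_mk, Prod.mk.injEq] at hp hq
      omega
  have hclass : ∀ i j, j ∈ C i → C j = C i := by
    intro i j hj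
    have hj : t i = t j := by simpa [C] using hj
    simp only [C, hj]
  by_cases h4 : ∃ i, 4 ≤ (C i).card
  · left
    obtain ⟨i, hi⟩ := h4
    have hsum : ∑ j ∈ C i, (C j).card = (C i).card * (C i).card := by
      rw [Finset.sum_congr rfl (fun j hj => by rw [hclass i j hj]), Finset.sum_const, smul_eq_mul]
    have hsplit := Finset.sum_add_sum_compl (C i) fun j => (C j).card
    -- A class of size c contributes c² to the total 18, so c ≥ 5 is impossible; for c = 4 the
    -- remaining 2 leaves two singletons.
    have h44 : (C i).card = 4 := by
      rw [hsum, hcount] at hsplit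
      by_contra hne
      have : 5 ≤ (C i).card := by omega
      have := Nat.mul_le_mul this this
      omega
    have hc2 : (C i)ᶜ.card = 2 := by rw [Finset.card_compl, h44]; rfl
    obtain ⟨a, b, hab, e⟩ := Finset.card_eq_two.1 hc2
    have hin : ∀ k, k ≠ a → k ≠ b → t i = t k := by
      intro k hka hkb
      have : k ∉ (C i)ᶜ := by rw [e]; simp [hka, hkb]
      simpa [C] using this
    refine ⟨a, b, hab, fun hne => ?_, fun k l h1 h2 h3 h4 => (hin k h1 h2).symm.trans (hin l h3 h4)⟩
    rw [e, Finset.sum_pair hab, hsum, hcount, h44] at hsplit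
    have hb : b ∈ C a := by simp [C, hne]
    have : 1 < (C a).card := Finset.one_lt_card.2 ⟨a, hself a, b, hb, hab⟩
    have : 0 < (C b).card := Finset.card_pos.2 ⟨b, hself b⟩
    omega
  · right
    push Not at h4
    -- Six terms, each at most 3, have sum 18.
    have h3 : ∀ i, (C i).card = 3 := by
      intro i
      by_contra hne
      have : ∑ i, (C i).card < ∑ _i : Fin 6, 3 := by
        apply Finset.sum_lt_sum
        · exact fun j _ => by have := h4 j; omega
        · exact ⟨i, Finset.mem_univ i, by have := h4 i; omega⟩
      simp at this
      omega
    refine ⟨C 0, h3 0, fun i j hij => ?_⟩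
    by_cases hi : i ∈ C 0
    · have h1 : t 0 = t i := by simpa [C] using hi
      have h2 : t 0 = t j := by simpa [C] using hij.1 hi
      rw [← h1, h2]
    · have hj : j ∉ C 0 := fun hj => hi (hij.2 hj)
      have hsub : C i ⊆ (C 0)ᶜ := by
        intro k hk
        rw [Finset.mem_compl]
        intro hk0
        apply hi
        rw [← hclass 0 k hk0, hclass i k hk]
        exact hself i
      have : C i = (C 0)ᶜ := by
        apply Finset.eq_of_subset_of_card_le hsub
        rw [Finset.card_compl, h3, h3]
        decide
      have hj' : j ∈ C i := by rw [this, Finset.mem_compl]; exact hj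
      simpa [C] using hj'

lemma concurrent_comp {u : Fin 6 → Fin 3 → ℂ} {l s s' : Fin 6 → Fin 6}
    (hl : Function.Surjective l) (h : ∀ m, l (s' m) = s (l m)) :
    Concurrent (fun i => u (l i)) s' ↔ Concurrent u s := by
  refine exists_congr fun x => and_congr_right fun _ => ?_
  simp only [Through, h]
  exact ⟨fun e m => by obtain ⟨n, rfl⟩ := hl m; exact e n, fun e m => e (l m)⟩

lemma GenPos.comp {u : Fin 6 → Fin 3 → ℂ} (h : GenPos u) {l : Fin 6 → Fin 6}
    (hl : Function.Injective l) : GenPos fun i => u (l i) :=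
  fun _ _ _ a b c => h _ _ _ (hl.ne a) (hl.ne b) (hl.ne c)

/-- Relabelings moving the last two totals to a given pair of totals. -/
def quadLabel : Fin 15 → Fin 6 → Fin 6 :=
  ![![0, 1, 2, 4, 3, 5], ![0, 2, 1, 3, 4, 5], ![0, 4, 1, 5, 2, 3], ![0, 5, 1, 2, 3, 4],
    ![0, 3, 1, 4, 2, 5], ![0, 5, 1, 4, 2, 3], ![0, 3, 1, 2, 4, 5], ![0, 4, 1, 3, 2, 5],
    ![0, 2, 1, 5, 3, 4], ![0, 1, 2, 5, 3, 4], ![0, 3, 1, 5, 2, 4], ![0, 4, 1, 2, 3, 5],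
    ![0, 2, 1, 4, 3, 5], ![0, 5, 1, 3, 2, 4], ![0, 1, 2, 3, 4, 5]]

/-- Relabelings moving the first three totals to a given triple of totals or its complement. -/
def triLabel : Fin 10 → Fin 6 → Fin 6 :=
  ![![0, 1, 2, 3, 4, 5], ![0, 1, 3, 2, 5, 4], ![0, 1, 4, 2, 3, 5], ![0, 1, 2, 4, 5, 3],
    ![0, 1, 2, 3, 5, 4], ![0, 2, 3, 1, 4, 5], ![0, 2, 3, 1, 5, 4], ![0, 2, 4, 1, 3, 5],
    ![0, 3, 4, 1, 2, 5], ![0, 1, 3, 2, 4, 5]]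

lemma quadLabel_injective : ∀ k, Function.Injective (quadLabel k) := by decide +kernel

lemma triLabel_injective : ∀ k, Function.Injective (triLabel k) := by decide +kernel

/-- Permutations of the points act on the totals, and transitively on pairs of totals; the table has
one relabeling for each pair. -/
lemma exists_quadLabel : ∀ a b : Fin 6, a ≠ b → ∃ k,
    (∀ m, quadLabel k (syn 4 5 m) = syn a b (quadLabel k m)) ∧
    ∀ i j : Fin 6, i < 4 → j < 4 → ∃ i' j', i' ≠ a ∧ i' ≠ b ∧ j' ≠ a ∧ j' ≠ b ∧
      ∀ m, quadLabel k (syn i j m) = syn i' j' (quadLabel k m) := by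
  decide +kernel

/-- The same for a splitting of the totals into two triples. A triple and its complement define the
same splitting, so ten relabelings suffice. -/
lemma exists_triLabel : ∀ B : Finset (Fin 6), B.card = 3 → ∃ k,
    ∀ i j : Fin 6, (i < 3 ↔ j < 3) → ∃ i' j', (i' ∈ B ↔ j' ∈ B) ∧
      ∀ m, triLabel k (syn i j m) = syn i' j' (triLabel k m) := by
  decide +kernel

/-- The configurations of the main family, suitably labeled: the lines joining the pairs `{0, 1}`,
`{2, 3}`, `{4, 5}` form a triangle, and each side passes through two triple points. -/
structure IsQuad (u : Fin 6 → Fin 3 → ℂ) : Prop where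
  genPos : GenPos u
  concurrent : ∀ i j : Fin 6, i < 4 → j < 4 → Concurrent u (syn i j)
  not_concurrent : ¬ Concurrent u (syn 4 5)

/-- The configurations of two triangles in sixfold perspective, suitably labeled. -/
structure IsTri (u : Fin 6 → Fin 3 → ℂ) : Prop where
  genPos : GenPos u
  concurrent : ∀ i j : Fin 6, (i < 3 ↔ j < 3) → Concurrent u (syn i j)

lemma exists_label {u : Fin 6 → Fin 3 → ℂ} (h : PropertyP (pointSet u)) :
    ∃ l : Fin 6 → Fin 6, Function.Bijective l ∧
      (IsQuad (fun i => u (l i)) ∨ IsTri fun i => u (l i)) := by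
  obtain ⟨hg, h6, -⟩ := propertyP_pointSet_iff.1 h
  rcases classification h6 with ⟨a, b, hab, hne, heq⟩ | ⟨B, hB, heq⟩
  · obtain ⟨k, hk, hk'⟩ := exists_quadLabel a b hab
    have hb := Finite.injective_iff_bijective.1 (quadLabel_injective k)
    refine ⟨_, hb, Or.inl ⟨hg.comp hb.1, fun i j hi hj => ?_, ?_⟩⟩
    · obtain ⟨i', j', h1, h2, h3, h4, e⟩ := hk' i j hi hj
      rw [concurrent_comp hb.2 e, concurrent_iff_joubert]
      exact heq _ _ h1 h2 h3 h4
    · rw [concurrent_comp hb.2 hk, concurrent_iff_joubert]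
      exact hne
  · obtain ⟨k, hk⟩ := exists_triLabel B hB
    have hb := Finite.injective_iff_bijective.1 (triLabel_injective k)
    refine ⟨_, hb, Or.inr ⟨hg.comp hb.1, fun i j hij => ?_⟩⟩
    obtain ⟨i', j', h1, e⟩ := hk i j hij
    rw [concurrent_comp hb.2 e, concurrent_iff_joubert]
    exact heq _ _ h1

/-! ### The main family: normal form and triple points -/

/-- The sextuples `(0, 1, ±α), (±β, 0, 1), (1, ±γ, 0)`. -/
def std (α β γ : ℂ) : Fin 6 → Fin 3 → ℂ :=
  ![![0, 1, α], ![0, 1, -α], ![β, 0, 1], ![-β, 0, 1], ![1, γ, 0], ![1, -γ, 0]]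

/-- The pair containing an index. -/
def pairOf : Fin 6 → Fin 3 := ![0, 0, 1, 1, 2, 2]

/-- Complex conjugation of the coordinates. -/
noncomputable def conjVec (x : Fin 3 → ℂ) : Fin 3 → ℂ := fun i => starRingEnd ℂ (x i)

lemma eq_neg_of_cross_eq {a a' b b' : ℂ} (hb : b ≠ 0) (hb' : b' ≠ 0)
    (hne : a' ≠ a) (h1 : a' * b' = a * b) (h2 : a' * b = a * b') : a' = -a := by
  have h : (a' - a) * (a' + a) * (b * b') = 0 := by
    linear_combination (a' * b) * h1 + (a * b) * h2
  have hbb : b * b' ≠ 0 := mul_ne_zero hb hb'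
  have := (mul_eq_zero.1 ((mul_eq_zero.1 h).resolve_right hbb)).resolve_left (sub_ne_zero.2 hne)
  linear_combination this

/-- With each pair on its coordinate line, concurrences become product relations between the
coordinate ratios of the points. They force the two ratios on each side to be opposite. -/
lemma IsQuad.exists_std {w : Fin 6 → Fin 3 → ℂ} (h : IsQuad w) (h0 : ∀ m, w m (pairOf m) = 0) :
    ∃ α β γ : ℂ, α ≠ 0 ∧ β ≠ 0 ∧ γ ≠ 0 ∧
      ∃ c : Fin 6 → ℂ, (∀ m, c m ≠ 0) ∧ ∀ m, w m = c m • std α β γ m := by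
  have hg := h.genPos
  have e0 : w 0 0 = 0 := h0 0
  have e1 : w 1 0 = 0 := h0 1
  have e2 : w 2 1 = 0 := h0 2
  have e3 : w 3 1 = 0 := h0 3
  have e4 : w 4 2 = 0 := h0 4
  have e5 : w 5 2 = 0 := h0 5
  have p0 : w 0 1 ≠ 0 := fun e => hg 0 2 3 (by decide) (by decide) (by decide)
    (by simp [bracket, e0, e2, e3, e])
  have q0 : w 0 2 ≠ 0 := fun e => hg 0 4 5 (by decide) (by decide) (by decide)
    (by simp [bracket, e0, e4, e5, e])
  have p1 : w 1 1 ≠ 0 := fun e => hg 1 2 3 (by decide) (by decide) (by decide)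
    (by simp [bracket, e1, e2, e3, e])
  have q1 : w 1 2 ≠ 0 := fun e => hg 1 4 5 (by decide) (by decide) (by decide)
    (by simp [bracket, e1, e4, e5, e])
  have r2 : w 2 0 ≠ 0 := fun e => hg 2 0 1 (by decide) (by decide) (by decide)
    (by simp [bracket, e0, e1, e2, e])
  have s2 : w 2 2 ≠ 0 := fun e => hg 2 4 5 (by decide) (by decide) (by decide)
    (by simp [bracket, e4, e5, e2, e])
  have r3 : w 3 0 ≠ 0 := fun e => hg 3 0 1 (by decide) (by decide) (by decide)
    (by simp [bracket, e0, e1, e3, e])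
  have s3 : w 3 2 ≠ 0 := fun e => hg 3 4 5 (by decide) (by decide) (by decide)
    (by simp [bracket, e4, e5, e3, e])
  have x4 : w 4 0 ≠ 0 := fun e => hg 4 0 1 (by decide) (by decide) (by decide)
    (by simp [bracket, e0, e1, e4, e])
  have y4 : w 4 1 ≠ 0 := fun e => hg 4 2 3 (by decide) (by decide) (by decide)
    (by simp [bracket, e2, e3, e4, e])
  have x5 : w 5 0 ≠ 0 := fun e => hg 5 0 1 (by decide) (by decide) (by decide)
    (by simp [bracket, e0, e1, e5, e])
  -- F and G are the factors by which the concurrence determinants exceed the product relations; A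
  -- says that the two points on the first side differ.
  have F : w 4 0 * w 5 1 - w 4 1 * w 5 0 ≠ 0 := fun e =>
    hg 0 4 5 (by decide) (by decide) (by decide) (by
      simp only [bracket, e0, e4, e5]; linear_combination w 0 2 * e)
  have G : w 2 0 * w 3 2 - w 2 2 * w 3 0 ≠ 0 := fun e =>
    hg 0 2 3 (by decide) (by decide) (by decide) (by
      simp only [bracket, e0, e2, e3]; linear_combination -w 0 1 * e)
  have A : w 0 1 * w 1 2 - w 0 2 * w 1 1 ≠ 0 := fun e =>
    hg 2 0 1 (by decide) (by decide) (by decide) (by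
      simp only [bracket, e0, e1, e2]; linear_combination w 2 0 * e)
  have c1 := (concurrent_iff w (syn 0 2) 0 2 1 3 4 5 (by decide) (by decide) (by decide)
    (by decide)).1 (h.concurrent 0 2 (by decide) (by decide))
  have c2 := (concurrent_iff w (syn 1 3) 0 3 1 2 4 5 (by decide) (by decide) (by decide)
    (by decide)).1 (h.concurrent 1 3 (by decide) (by decide))
  have c3 := (concurrent_iff w (syn 0 3) 0 4 1 5 2 3 (by decide) (by decide) (by decide)
    (by decide)).1 (h.concurrent 0 3 (by decide) (by decide))
  simp only [conc, bracket, e0, e1, e2, e3, e4, e5] at c1 c2 c3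
  have d1 : w 0 1 * w 1 2 * w 2 2 * w 3 0 = w 1 1 * w 0 2 * w 2 0 * w 3 2 :=
    mul_left_cancel₀ F (by linear_combination c1)
  have d2 : w 0 1 * w 1 2 * w 3 2 * w 2 0 = w 1 1 * w 0 2 * w 3 0 * w 2 2 :=
    mul_left_cancel₀ F (by linear_combination c2)
  have d3 : w 0 2 * w 4 1 * w 1 1 * w 5 0 = w 1 2 * w 5 1 * w 0 1 * w 4 0 :=
    mul_left_cancel₀ G (by linear_combination c3)
  have α' : w 1 2 / w 1 1 = -(w 0 2 / w 0 1) := by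
    refine eq_neg_of_cross_eq (b := w 2 0 / w 2 2) (b' := w 3 0 / w 3 2) (div_ne_zero r2 s2)
      (div_ne_zero r3 s3) ?_ ?_ ?_
    · intro e
      rw [div_eq_div_iff p1 p0] at e
      exact A (by linear_combination e)
    · field_simp
      linear_combination d1
    · field_simp
      linear_combination d2
  have hα : w 0 2 / w 0 1 ≠ 0 := div_ne_zero q0 p0
  have β' : w 3 0 / w 3 2 = -(w 2 0 / w 2 2) := by
    have : w 1 2 / w 1 1 * (w 3 0 / w 3 2) = w 0 2 / w 0 1 * (w 2 0 / w 2 2) := by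
      field_simp
      linear_combination d1
    rw [α'] at this
    exact mul_left_cancel₀ hα (by linear_combination -this)
  have γ' : w 5 1 / w 5 0 = -(w 4 1 / w 4 0) := by
    have : w 1 2 / w 1 1 * (w 5 1 / w 5 0) = w 0 2 / w 0 1 * (w 4 1 / w 4 0) := by
      field_simp
      linear_combination -d3
    rw [α'] at this
    exact mul_left_cancel₀ hα (by linear_combination -this)
  refine ⟨w 0 2 / w 0 1, w 2 0 / w 2 2, w 4 1 / w 4 0, hα, div_ne_zero r2 s2, div_ne_zero y4 x4,
    ![w 0 1, w 1 1, w 2 2, w 3 2, w 4 0, w 5 0], ?_, ?_⟩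
  · intro m
    fin_cases m <;> assumption
  · have hstd : std (w 0 2 / w 0 1) (w 2 0 / w 2 2) (w 4 1 / w 4 0) =
        ![![0, 1, w 0 2 / w 0 1], ![0, 1, w 1 2 / w 1 1], ![w 2 0 / w 2 2, 0, 1],
          ![w 3 0 / w 3 2, 0, 1], ![1, w 4 1 / w 4 0, 0], ![1, w 5 1 / w 5 0, 0]] := by
      rw [std, α', β', γ']
    rw [hstd]
    clear α' β' γ' hstd d1 d2 d3 c1 c2 c3
    intro m
    ext i
    fin_cases m <;> fin_cases i <;> simp [*, mul_div_cancel₀]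

/-- The linear equivalence with the given rows. -/
noncomputable def ofRows (a b c : Fin 3 → ℂ) (h : bracket a b c ≠ 0) :
    (Fin 3 → ℂ) ≃ₗ[ℂ] (Fin 3 → ℂ) :=
  LinearMap.equivOfDetNeZero (Matrix.toLin' (Matrix.of ![a, b, c])) (by
    rw [LinearMap.det_toLin']
    rw [← dot_cross_eq_bracket, triple_product_eq_det] at h
    exact h)

lemma ofRows_apply (a b c : Fin 3 → ℂ) (h : bracket a b c ≠ 0) (x : Fin 3 → ℂ) :
    ofRows a b c h x = ![a ⬝ᵥ x, b ⬝ᵥ x, c ⬝ᵥ x] := by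
  ext i
  fin_cases i <;> simp [ofRows, LinearMap.equivOfDetNeZero, Matrix.mulVec]

/-- The linear equivalence is defined over the reals. -/
def IsRealEquiv (g : (Fin 3 → ℂ) ≃ₗ[ℂ] (Fin 3 → ℂ)) : Prop :=
  ∀ x, conjVec (g x) = g (conjVec x)

lemma IsRealEquiv.symm {g : (Fin 3 → ℂ) ≃ₗ[ℂ] (Fin 3 → ℂ)} (h : IsRealEquiv g) :
    IsRealEquiv g.symm := by
  intro x
  apply g.injective
  rw [← h, g.apply_symm_apply, g.apply_symm_apply]

lemma conjVec_cross (x y : Fin 3 → ℂ) :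
    conjVec (crossProduct x y) = crossProduct (conjVec x) (conjVec y) := by
  ext i
  fin_cases i <;> simp [conjVec, cross_apply]

lemma conj_dotProduct (x y : Fin 3 → ℂ) :
    starRingEnd ℂ (x ⬝ᵥ y) = conjVec x ⬝ᵥ conjVec y := by
  simp [conjVec, dotProduct]

lemma conj_bracket (x y z : Fin 3 → ℂ) :
    starRingEnd ℂ (bracket x y z) = bracket (conjVec x) (conjVec y) (conjVec z) := by
  simp [conjVec, bracket]

lemma isRealEquiv_ofRows {a b c : Fin 3 → ℂ} (h : bracket a b c ≠ 0) (ha : conjVec a = a)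
    (hb : conjVec b = b) (hc : conjVec c = c) : IsRealEquiv (ofRows a b c h) := by
  intro x
  rw [ofRows_apply, ofRows_apply]
  ext i
  fin_cases i
  · simp [conjVec, conj_dotProduct, ha]
  · simp [conjVec, conj_dotProduct, hb]
  · simp [conjVec, conj_dotProduct, hc]

/-- The syntheme 01|23|45 is the one common to totals 4 and 5. Its lines are not concurrent, so they
can be taken as the rows of an invertible map, which sends them to the coordinate lines. -/
lemma IsQuad.exists_frame {w : Fin 6 → Fin 3 → ℂ} (h : IsQuad w) :
    ∃ g : (Fin 3 → ℂ) ≃ₗ[ℂ] (Fin 3 → ℂ), (∀ m, g (w m) (pairOf m) = 0) ∧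
      ((∀ m, conjVec (w m) = w m) → IsRealEquiv g) := by
  have hd : bracket (crossProduct (w 0) (w 1)) (crossProduct (w 2) (w 3))
      (crossProduct (w 4) (w 5)) ≠ 0 := by
    intro e
    apply h.not_concurrent
    rw [concurrent_iff w (syn 4 5) 0 1 2 3 4 5 (by decide) (by decide) (by decide) (by decide),
      ← e]
    simp [conc, bracket, cross_apply]
    ring
  refine ⟨ofRows _ _ _ hd, fun m => ?_, fun hr => ?_⟩
  · rw [ofRows_apply]
    fin_cases m <;> simp [pairOf, dotProduct_comm _ (w _)]
  · apply isRealEquiv_ofRows <;> rw [conjVec_cross, hr, hr]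

lemma isQuad_map (g : (Fin 3 → ℂ) ≃ₗ[ℂ] (Fin 3 → ℂ)) {u : Fin 6 → Fin 3 → ℂ} :
    IsQuad (fun i => g (u i)) ↔ IsQuad u := by
  constructor
  · rintro ⟨h1, h2, h3⟩
    simp only [genPos_map, concurrent_map] at h1 h2 h3
    exact ⟨h1, h2, h3⟩
  · rintro ⟨h1, h2, h3⟩
    constructor <;> simpa only [genPos_map, concurrent_map]

lemma IsQuad.exists_normalForm {w : Fin 6 → Fin 3 → ℂ} (h : IsQuad w) :
    ∃ (g : (Fin 3 → ℂ) ≃ₗ[ℂ] (Fin 3 → ℂ)) (α β γ : ℂ), α ≠ 0 ∧ β ≠ 0 ∧ γ ≠ 0 ∧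
      (∃ c : Fin 6 → ℂ, (∀ m, c m ≠ 0) ∧ ∀ m, w m = c m • g (std α β γ m)) ∧
      ((∀ m, conjVec (w m) = w m) → IsRealEquiv g) := by
  obtain ⟨g, hg, hr⟩ := h.exists_frame
  obtain ⟨α, β, γ, hα, hβ, hγ, c, hc, e⟩ := ((isQuad_map g).2 h).exists_std hg
  refine ⟨g.symm, α, β, γ, hα, hβ, hγ, ⟨c, hc, fun m => ?_⟩, fun hw => (hr hw).symm⟩
  rw [← map_smul, ← e, g.symm_apply_apply]

/-- Up to a nonzero monomial factor, every bracket is a constant or 1 ± αβγ. -/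
lemma genPos_std {α β γ : ℂ} (hα : α ≠ 0) (hβ : β ≠ 0) (hγ : γ ≠ 0)
    (h1 : (α * β * γ) ^ 2 ≠ 1) : GenPos (std α β γ) := by
  have hp : 1 + α * β * γ ≠ 0 := fun e => h1 (by linear_combination (α * β * γ - 1) * e)
  have hm : 1 - α * β * γ ≠ 0 := fun e => h1 (by linear_combination (-α * β * γ - 1) * e)
  apply genPos_of_lt
  intro i j k hij hjk
  fin_cases i <;> fin_cases j <;> (try exact absurd hij (by decide)) <;> fin_cases k <;>
    (try exact absurd hjk (by decide))
  · have e : bracket (std α β γ 0) (std α β γ 1) (std α β γ 2) = -(2 * α * β) := by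
      simp [bracket, std]
      try ring
    refine e.trans_ne ?_
    simp [hα, hβ]
  · have e : bracket (std α β γ 0) (std α β γ 1) (std α β γ 3) = 2 * α * β := by
      simp [bracket, std]
      try ring
    refine e.trans_ne ?_
    simp [hα, hβ]
  · have e : bracket (std α β γ 0) (std α β γ 1) (std α β γ 4) = -(2 * α) := by
      simp [bracket, std]
      try ring
    refine e.trans_ne ?_
    simp [hα]
  · have e : bracket (std α β γ 0) (std α β γ 1) (std α β γ 5) = -(2 * α) := by
      simp [bracket, std]
      try ring
    refine e.trans_ne ?_
    simp [hα]
  · have e : bracket (std α β γ 0) (std α β γ 2) (std α β γ 3) = -(2 * β) := by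
      simp [bracket, std]
      try ring
    refine e.trans_ne ?_
    simp [hβ]
  · have e : bracket (std α β γ 0) (std α β γ 2) (std α β γ 4) = 1 + α * β * γ := by
      simp [bracket, std]
      try ring
    refine e.trans_ne ?_
    assumption
  · have e : bracket (std α β γ 0) (std α β γ 2) (std α β γ 5) = 1 - α * β * γ := by
      simp [bracket, std]
      try ring
    refine e.trans_ne ?_
    assumption
  · have e : bracket (std α β γ 0) (std α β γ 3) (std α β γ 4) = 1 - α * β * γ := by
      simp [bracket, std]
      try ring
    refine e.trans_ne ?_
    assumption
  · have e : bracket (std α β γ 0) (std α β γ 3) (std α β γ 5) = 1 + α * β * γ := by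
      simp [bracket, std]
      try ring
    refine e.trans_ne ?_
    assumption
  · have e : bracket (std α β γ 0) (std α β γ 4) (std α β γ 5) = -(2 * α * γ) := by
      simp [bracket, std]
      try ring
    refine e.trans_ne ?_
    simp [hα, hγ]
  · have e : bracket (std α β γ 1) (std α β γ 2) (std α β γ 3) = -(2 * β) := by
      simp [bracket, std]
      try ring
    refine e.trans_ne ?_
    simp [hβ]
  · have e : bracket (std α β γ 1) (std α β γ 2) (std α β γ 4) = 1 - α * β * γ := by
      simp [bracket, std]
      try ring
    refine e.trans_ne ?_
    assumption
  · have e : bracket (std α β γ 1) (std α β γ 2) (std α β γ 5) = 1 + α * β * γ := by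
      simp [bracket, std]
      try ring
    refine e.trans_ne ?_
    assumption
  · have e : bracket (std α β γ 1) (std α β γ 3) (std α β γ 4) = 1 + α * β * γ := by
      simp [bracket, std]
      try ring
    refine e.trans_ne ?_
    assumption
  · have e : bracket (std α β γ 1) (std α β γ 3) (std α β γ 5) = 1 - α * β * γ := by
      simp [bracket, std]
      try ring
    refine e.trans_ne ?_
    assumption
  · have e : bracket (std α β γ 1) (std α β γ 4) (std α β γ 5) = 2 * α * γ := by
      simp [bracket, std]
      try ring
    refine e.trans_ne ?_
    simp [hα, hγ]
  · have e : bracket (std α β γ 2) (std α β γ 3) (std α β γ 4) = -(2 * β * γ) := by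
      simp [bracket, std]
      try ring
    refine e.trans_ne ?_
    simp [hβ, hγ]
  · have e : bracket (std α β γ 2) (std α β γ 3) (std α β γ 5) = 2 * β * γ := by
      simp [bracket, std]
      try ring
    refine e.trans_ne ?_
    simp [hβ, hγ]
  · have e : bracket (std α β γ 2) (std α β γ 4) (std α β γ 5) = -(2 * γ) := by
      simp [bracket, std]
      try ring
    refine e.trans_ne ?_
    simp [hγ]
  · have e : bracket (std α β γ 3) (std α β γ 4) (std α β γ 5) = -(2 * γ) := by
      simp [bracket, std]
      try ring
    refine e.trans_ne ?_
    simp [hγ]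

lemma joubert_std (α β γ : ℂ) : joubert (std α β γ) =
    ![0, 0, 0, 0, (α * β * γ) ^ 2 + 4 * (α * β * γ) - 1,
      (α * β * γ) ^ 2 - 4 * (α * β * γ) - 1] := by
  ext i
  fin_cases i <;> simp [joubert, conc, bracket, std] <;> ring

lemma card_pairs_of_four {t : Fin 6 → ℂ} {x y : ℂ} (ht : t = ![0, 0, 0, 0, x, y]) (hx : x ≠ 0)
    (hy : y ≠ 0) (hxy : x ≠ y) : coincidences t = 6 := by
  classical
  have : (pairs.filter fun p => t p.1 = t p.2) = pairs.filter fun p => p.1 < 4 ∧ p.2 < 4 := by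
    apply Finset.filter_congr
    rintro ⟨i, j⟩ hij
    rw [mem_pairs] at hij
    subst ht
    fin_cases i <;> fin_cases j <;> (try exact absurd hij (by decide)) <;>
      simp [hxy, hx.symm, hy.symm]
  have h6 : (pairs.filter fun p => p.1 < 4 ∧ p.2 < 4).card = 6 := by decide
  rw [← h6, ← this, coincidences]

lemma quadraticForm_apply (Q : QuadraticForm ℂ (Fin 3 → ℂ)) :
    ∃ A B C D E F : ℂ, ∀ x, Q x = A * x 0 ^ 2 + B * x 1 ^ 2 + C * x 2 ^ 2 + D * (x 1 * x 2) +
      E * (x 0 * x 2) + F * (x 0 * x 1) := by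
  refine ⟨Q (Pi.single 0 1), Q (Pi.single 1 1), Q (Pi.single 2 1),
    QuadraticMap.polar Q (Pi.single 1 1) (Pi.single 2 1),
    QuadraticMap.polar Q (Pi.single 0 1) (Pi.single 2 1),
    QuadraticMap.polar Q (Pi.single 0 1) (Pi.single 1 1), fun x => ?_⟩
  have hx : x = x 0 • Pi.single 0 1 + x 1 • Pi.single 1 1 + x 2 • Pi.single 2 1 := by
    ext i
    fin_cases i <;> simp
  conv_lhs => rw [hx]
  rw [QuadraticMap.map_add Q, QuadraticMap.map_add Q]
  simp only [QuadraticMap.map_smul, QuadraticMap.polar_add_left, QuadraticMap.polar_smul_left,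
    QuadraticMap.polar_smul_right, smul_eq_mul]
  ring

/-- Comparing the opposite points on each side kills the mixed coefficients. The three diagonal
coefficients then satisfy a linear system of determinant 1 + (αβγ)². -/
lemma not_onConic_std {α β γ : ℂ} (hα : α ≠ 0) (hβ : β ≠ 0) (hγ : γ ≠ 0)
    (h1 : (α * β * γ) ^ 2 ≠ -1) :
    ¬ ∃ Q : QuadraticForm ℂ (Fin 3 → ℂ), Q ≠ 0 ∧ ∀ i, Q (std α β γ i) = 0 := by
  rintro ⟨Q, hQ, h⟩
  obtain ⟨A, B, C, D, E, F, e⟩ := quadraticForm_apply Q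
  simp only [e] at h
  have h0 := h 0
  have h2 := h 1
  have h3 := h 2
  have h4 := h 3
  have h5 := h 4
  have h6 := h 5
  simp [std] at h0 h2 h3 h4 h5 h6
  have hD : D = 0 := mul_right_cancel₀ (mul_ne_zero two_ne_zero hα) (by linear_combination h0 - h2)
  have hE : E = 0 := mul_right_cancel₀ (mul_ne_zero two_ne_zero hβ) (by linear_combination h3 - h4)
  have hF : F = 0 := mul_right_cancel₀ (mul_ne_zero two_ne_zero hγ) (by linear_combination h5 - h6)
  subst hD hE hF
  have hk : (α * β * γ) ^ 2 + 1 ≠ 0 := fun e => h1 (by linear_combination e)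
  have hC : C = 0 := mul_right_cancel₀ hk (by
    linear_combination h3 - β ^ 2 * h5 + β ^ 2 * γ ^ 2 * h0)
  subst hC
  have hB : B = 0 := by linear_combination h0
  subst hB
  have hA : A = 0 := by linear_combination h5
  subst hA
  apply hQ
  ext x
  rw [e]
  simp

lemma propertyP_std {α β γ : ℂ} (hα : α ≠ 0) (hβ : β ≠ 0) (hγ : γ ≠ 0)
    (h1 : (α * β * γ) ^ 2 ≠ 1) (h2 : (α * β * γ) ^ 2 ≠ -1)
    (h3 : ((α * β * γ) ^ 2 - 1) ^ 2 ≠ 16 * (α * β * γ) ^ 2) :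
    PropertyP (pointSet (std α β γ)) := by
  rw [propertyP_pointSet_iff]
  refine ⟨genPos_std hα hβ hγ h1, card_pairs_of_four (joubert_std α β γ) ?_ ?_ ?_,
    not_onConic_std hα hβ hγ h2⟩
  · exact fun e => h3 (by linear_combination ((α * β * γ) ^ 2 - 4 * (α * β * γ) - 1) * e)
  · exact fun e => h3 (by linear_combination ((α * β * γ) ^ 2 + 4 * (α * β * γ) - 1) * e)
  · intro e
    have : 8 * (α * β * γ) = 0 := by linear_combination e
    simp [hα, hβ, hγ] at this

lemma sq_ne_one_of_genPos_std {α β γ : ℂ} (h : GenPos (std α β γ)) : (α * β * γ) ^ 2 ≠ 1 := by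
  intro e
  have h1 := h 0 2 4 (by decide) (by decide) (by decide)
  have h2 := h 0 2 5 (by decide) (by decide) (by decide)
  have e' : (1 + α * β * γ) * (1 - α * β * γ) = 0 := by linear_combination -e
  rcases mul_eq_zero.1 e' with e' | e'
  · exact h1 (by simp [bracket, std]; linear_combination e')
  · exact h2 (by simp [bracket, std]; linear_combination e')

lemma sq_ne_neg_one_of_propertyP_std {α β γ : ℂ} (h : PropertyP (pointSet (std α β γ))) :
    (α * β * γ) ^ 2 ≠ -1 := by
  intro e
  refine (propertyP_pointSet_iff.1 h).2.2
    -- This diagonal conic always passes through the points on the first two sides; on the third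
    -- side its value is -1 - (αβγ)².
    ⟨QuadraticMap.weightedSumSquares ℂ ![-1, -(α ^ 2 * β ^ 2), β ^ 2], fun h0 => ?_, fun i => ?_⟩
  · have := congrArg (fun q : QuadraticForm ℂ (Fin 3 → ℂ) => q (Pi.single 0 1)) h0
    simp [QuadraticMap.weightedSumSquares_apply, Fin.sum_univ_three] at this
  · fin_cases i <;> simp [QuadraticMap.weightedSumSquares_apply, Fin.sum_univ_three, std] <;>
      first | ring1 | linear_combination -e

/-- The synthemes used are those of the six pairs among the first four totals. The resulting points
again lie in opposite pairs on the sides of the reference triangle. -/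
lemma through_std {α β γ : ℂ} (hα : α ≠ 0) (hβ : β ≠ 0) (hγ : γ ≠ 0) (m : Fin 6) :
    ∃ i j, i < j ∧
      Through (std α β γ) (syn i j) (std (β * γ)⁻¹ (α * γ)⁻¹ (α * β)⁻¹ m) := by
  fin_cases m
  · refine ⟨2, 3, by decide, fun k => ?_⟩
    fin_cases k <;> simp [bracket, std, syn] <;> field_simp <;> ring
  · refine ⟨0, 1, by decide, fun k => ?_⟩
    fin_cases k <;> simp [bracket, std, syn] <;> field_simp <;> ring
  · refine ⟨1, 2, by decide, fun k => ?_⟩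
    fin_cases k <;> simp [bracket, std, syn] <;> field_simp <;> ring
  · refine ⟨0, 3, by decide, fun k => ?_⟩
    fin_cases k <;> simp [bracket, std, syn] <;> field_simp <;> ring
  · refine ⟨1, 3, by decide, fun k => ?_⟩
    fin_cases k <;> simp [bracket, std, syn] <;> field_simp <;> ring
  · refine ⟨0, 2, by decide, fun k => ?_⟩
    fin_cases k <;> simp [bracket, std, syn] <;> field_simp <;> ring

/-- The effect of passing to triple points on the modulus: k becomes k⁻². -/
lemma dual_prod (α β γ : ℂ) (hα : α ≠ 0) (hβ : β ≠ 0) (hγ : γ ≠ 0) :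
    (β * γ)⁻¹ * (α * γ)⁻¹ * (α * β)⁻¹ = ((α * β * γ) ^ 2)⁻¹ := by
  field_simp

lemma genPos_std_dual {α β γ : ℂ} (hα : α ≠ 0) (hβ : β ≠ 0) (hγ : γ ≠ 0)
    {g : (Fin 3 → ℂ) ≃ₗ[ℂ] (Fin 3 → ℂ)} (h : PropertyP (pointSet fun i => g (std α β γ i))) :
    GenPos (std (β * γ)⁻¹ (α * γ)⁻¹ (α * β)⁻¹) := by
  have h' := (propertyP_map g).1 h
  have h1 := sq_ne_one_of_genPos_std (propertyP_pointSet_iff.1 h').1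
  have h2 := sq_ne_neg_one_of_propertyP_std h'
  refine genPos_std (by simp [*]) (by simp [*]) (by simp [*]) ?_
  rw [dual_prod α β γ hα hβ hγ, inv_pow, ne_eq, inv_eq_one]
  intro e
  rcases mul_eq_zero.1 (show ((α * β * γ) ^ 2 - 1) * ((α * β * γ) ^ 2 + 1) = 0 by
    linear_combination e) with e | e
  · exact h1 (by linear_combination e)
  · exact h2 (by linear_combination e)

lemma triplePoints_std {α β γ : ℂ} (hα : α ≠ 0) (hβ : β ≠ 0) (hγ : γ ≠ 0)
    (g : (Fin 3 → ℂ) ≃ₗ[ℂ] (Fin 3 → ℂ)) (h : PropertyP (pointSet fun i => g (std α β γ i))) :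
    triplePoints (pointSet fun i => g (std α β γ i)) =
      pointSet fun i => g (std (β * γ)⁻¹ (α * γ)⁻¹ (α * β)⁻¹ i) := by
  refine triplePoints_eq h ?_ ?_
  · rw [genPos_map]
    exact genPos_std_dual hα hβ hγ h
  · intro m
    obtain ⟨i, j, hij, ht⟩ := through_std hα hβ hγ m
    exact ⟨i, j, hij, (through_map g _ _ _).2 ht⟩

/-! ### The second family: two triangles in sixfold perspective -/

/-- Two triangles in sixfold perspective, where `ω` is a primitive cube root of unity. -/
def stdTri (ω : ℂ) : Fin 6 → Fin 3 → ℂ :=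
  ![![1, 0, 0], ![1, 1, 1], ![1, ω, ω ^ 2], ![0, 1, 0], ![0, 0, 1], ![1, ω ^ 2, ω]]

/-- With four points as projective frame, four concurrences force the other two to be (1, b, b²) and
(1, b², b) with b³ = 1; here b ≠ 1, since otherwise points 1 and 2 would coincide. -/
lemma IsTri.exists_std {y : Fin 6 → Fin 3 → ℂ} (h : IsTri y) (h01 : y 0 1 = 0) (h02 : y 0 2 = 0)
    (h30 : y 3 0 = 0) (h32 : y 3 2 = 0) (h40 : y 4 0 = 0) (h41 : y 4 1 = 0)
    (h1 : y 1 = ![1, 1, 1]) :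
    ∃ c : Fin 6 → ℂ, (∀ m, c m ≠ 0) ∧ (∀ m, y m = c m • stdTri (y 2 1 / y 2 0) m) ∧
      (y 2 1 / y 2 0) ^ 2 + y 2 1 / y 2 0 + 1 = 0 := by
  have hg := h.genPos
  have h10 : y 1 0 = 1 := by rw [h1]; rfl
  have h11 : y 1 1 = 1 := by rw [h1]; rfl
  have h12 : y 1 2 = 1 := by rw [h1]; rfl
  have n0 : y 0 0 ≠ 0 := fun e => hg 0 1 2 (by decide) (by decide) (by decide)
    (by simp [bracket, h01, h02, e])
  have n3 : y 3 1 ≠ 0 := fun e => hg 3 1 2 (by decide) (by decide) (by decide)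
    (by simp [bracket, h30, h32, e])
  have n4 : y 4 2 ≠ 0 := fun e => hg 4 1 2 (by decide) (by decide) (by decide)
    (by simp [bracket, h40, h41, e])
  have n2 : y 2 0 ≠ 0 := fun e => hg 2 3 4 (by decide) (by decide) (by decide)
    (by simp [bracket, h30, h32, h40, h41, e])
  have n5 : y 5 0 ≠ 0 := fun e => hg 5 3 4 (by decide) (by decide) (by decide)
    (by simp [bracket, h30, h32, h40, h41, e])
  have n21 : y 2 1 ≠ 0 := fun e => hg 2 0 4 (by decide) (by decide) (by decide)
    (by simp [bracket, h01, h02, h40, h41, e])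
  have hn : y 0 0 * y 3 1 * y 4 2 ≠ 0 := mul_ne_zero (mul_ne_zero n0 n3) n4
  have c1 := (concurrent_iff y (syn 0 1) 0 1 2 4 3 5 (by decide) (by decide) (by decide)
    (by decide)).1 (h.concurrent 0 1 (by decide))
  have c2 := (concurrent_iff y (syn 0 2) 0 2 1 3 4 5 (by decide) (by decide) (by decide)
    (by decide)).1 (h.concurrent 0 2 (by decide))
  have c4 := (concurrent_iff y (syn 3 4) 0 2 1 4 3 5 (by decide) (by decide) (by decide)
    (by decide)).1 (h.concurrent 3 4 (by decide))
  have c5 := (concurrent_iff y (syn 3 5) 0 5 1 3 2 4 (by decide) (by decide) (by decide)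
    (by decide)).1 (h.concurrent 3 5 (by decide))
  simp only [conc, bracket, h01, h02, h30, h32, h40, h41, h10, h11, h12] at c1 c2 c4 c5
  have d1 : y 5 2 * y 2 0 = y 5 0 * y 2 1 :=
    mul_left_cancel₀ hn (by linear_combination c1)
  have d2 : y 2 1 * y 5 0 = y 2 2 * y 5 1 :=
    mul_left_cancel₀ hn (by linear_combination -c2)
  have d4 : y 2 1 * y 5 2 = y 2 2 * y 5 0 :=
    mul_left_cancel₀ hn (by linear_combination c4)
  have d5 : y 5 1 * y 2 0 = y 5 2 * y 2 1 :=
    mul_left_cancel₀ hn (by linear_combination c5)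
  obtain ⟨b, hb⟩ : ∃ b, b = y 2 1 / y 2 0 := ⟨_, rfl⟩
  have e21 : y 2 1 = y 2 0 * b := by rw [hb]; field_simp
  have hb0 : b ≠ 0 := by rw [hb]; exact div_ne_zero n21 n2
  have e52 : y 5 2 = y 5 0 * b := mul_right_cancel₀ n2 (by rw [d1, e21]; ring)
  have e51 : y 5 1 = y 5 0 * b ^ 2 := mul_right_cancel₀ n2 (by rw [d5, e21, e52]; ring)
  have e22 : y 2 2 = y 2 0 * b ^ 2 := mul_right_cancel₀ n5 (by rw [← d4, e21, e52]; ring)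
  have hb3 : b ^ 3 = 1 := by
    rw [e21, e22, e51] at d2
    exact mul_left_cancel₀ (mul_ne_zero (mul_ne_zero n2 n5) hb0) (by linear_combination -d2)
  have hb1 : b ≠ 1 := by
    intro e
    refine hg.not_smul (i := 2) (j := 1) (by decide) (y 2 0) ?_
    ext i
    fin_cases i <;> simp [h10, h11, h12, e21, e22, e]
  rw [← hb]
  refine ⟨![y 0 0, 1, y 2 0, y 3 1, y 4 2, y 5 0], ?_, ?_, ?_⟩
  · intro m
    fin_cases m <;> first | assumption | exact one_ne_zero
  · intro m
    ext i
    fin_cases m <;> fin_cases i <;>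
      simp [stdTri, h01, h02, h30, h32, h40, h41, h10, h11, h12, e21, e22, e51, e52]
  · refine mul_left_cancel₀ (sub_ne_zero.2 hb1) ?_
    linear_combination hb3

lemma isTri_map (g : (Fin 3 → ℂ) ≃ₗ[ℂ] (Fin 3 → ℂ)) {u : Fin 6 → Fin 3 → ℂ} :
    IsTri (fun i => g (u i)) ↔ IsTri u := by
  constructor
  · rintro ⟨h1, h2⟩
    simp only [genPos_map, concurrent_map] at h1 h2
    exact ⟨h1, h2⟩
  · rintro ⟨h1, h2⟩
    constructor <;> simpa only [genPos_map, concurrent_map]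

lemma conjVec_smul_of_real {a : ℂ} {x : Fin 3 → ℂ} (ha : starRingEnd ℂ a = a)
    (hx : conjVec x = x) : conjVec (a • x) = a • x := by
  ext i
  have := congrFun hx i
  simp only [conjVec] at this
  simp [conjVec, ha, this]

lemma IsTri.exists_normalForm {w : Fin 6 → Fin 3 → ℂ} (h : IsTri w) :
    ∃ (g : (Fin 3 → ℂ) ≃ₗ[ℂ] (Fin 3 → ℂ)) (ω : ℂ), ω ^ 2 + ω + 1 = 0 ∧
      (∃ c : Fin 6 → ℂ, (∀ m, c m ≠ 0) ∧ ∀ m, w m = c m • g (stdTri ω m)) ∧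
      ((∀ m, conjVec (w m) = w m) → starRingEnd ℂ ω = ω) := by
  have hg := h.genPos
  have hA := hg 1 3 4 (by decide) (by decide) (by decide)
  have hB := hg 1 4 0 (by decide) (by decide) (by decide)
  have hC := hg 1 0 3 (by decide) (by decide) (by decide)
  have hD := hg 0 3 4 (by decide) (by decide) (by decide)
  set A := bracket (w 1) (w 3) (w 4) with hA'
  set B := bracket (w 1) (w 4) (w 0) with hB'
  set C := bracket (w 1) (w 0) (w 3) with hC'
  -- The rows are the sides of the triangle 0, 3, 4, scaled so that point 1 goes to (1, 1, 1).
  have hdet : bracket (A⁻¹ • crossProduct (w 3) (w 4)) (B⁻¹ • crossProduct (w 4) (w 0))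
      (C⁻¹ • crossProduct (w 0) (w 3)) ≠ 0 := by
    rw [bracket_smul]
    have : bracket (crossProduct (w 3) (w 4)) (crossProduct (w 4) (w 0))
        (crossProduct (w 0) (w 3)) = bracket (w 0) (w 3) (w 4) ^ 2 := by
      simp [bracket, cross_apply]
      ring
    rw [this]
    simp [hA, hB, hC, hD]
  have hy : ∀ x, ofRows _ _ _ hdet x = ![A⁻¹ * bracket x (w 3) (w 4),
      B⁻¹ * bracket x (w 4) (w 0), C⁻¹ * bracket x (w 0) (w 3)] := by
    intro x
    rw [ofRows_apply]
    simp only [dotProduct_smul, smul_eq_mul, dotProduct_comm _ x, dot_cross_eq_bracket]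
  have hreal : (∀ m, conjVec (w m) = w m) → IsRealEquiv (ofRows _ _ _ hdet) := by
    intro hw
    have hbr : ∀ i j k, starRingEnd ℂ (bracket (w i) (w j) (w k))⁻¹ =
        (bracket (w i) (w j) (w k))⁻¹ := fun i j k => by
      rw [map_inv₀, conj_bracket, hw, hw, hw]
    apply isRealEquiv_ofRows <;> refine conjVec_smul_of_real (hbr _ _ _) ?_ <;>
      rw [conjVec_cross, hw, hw]
  generalize hG : ofRows _ _ _ hdet = G at hy hreal
  obtain ⟨c, hc, e, hω⟩ := ((isTri_map G).2 h).exists_std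
    (by simp [hy, bracket_self_outer]) (by simp [hy, bracket_self_left])
    (by simp [hy, bracket_self_left]) (by simp [hy, bracket_self_outer])
    (by simp [hy, bracket_self_outer]) (by simp [hy, bracket_self_left])
    (by rw [hy, ← hA', ← hB', ← hC', inv_mul_cancel₀ hA, inv_mul_cancel₀ hB, inv_mul_cancel₀ hC])
  refine ⟨G.symm, _, hω, ⟨c, hc, fun m => ?_⟩, fun hw => ?_⟩
  · rw [← map_smul, ← e, G.symm_apply_apply]
  · have h2 := hreal hw (w 2)
    rw [hw] at h2
    have h20 := congrFun h2 0
    have h21 := congrFun h2 1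
    simp only [conjVec] at h20 h21
    rw [map_div₀, h20, h21]

lemma not_real_of_cube_root {ω : ℂ} (h : ω ^ 2 + ω + 1 = 0) : starRingEnd ℂ ω ≠ ω := by
  intro hr
  obtain ⟨r, rfl⟩ := Complex.conj_eq_iff_real.1 hr
  have : r ^ 2 + r + 1 = 0 := by exact_mod_cast h
  nlinarith [sq_nonneg (2 * r + 1)]

lemma propertyP_triplePoints_stdTri {ω : ℂ} (hω : ω ^ 2 + ω + 1 = 0)
    (g : (Fin 3 → ℂ) ≃ₗ[ℂ] (Fin 3 → ℂ)) (h : PropertyP (pointSet fun i => g (stdTri ω i))) :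
    PropertyP (triplePoints (pointSet fun i => g (stdTri ω i))) := by
  have h3 : ω ^ 3 = 1 := by linear_combination (ω - 1) * hω
  -- This matrix carries the standard sextuple onto its own six triple points, so P' is projectively
  -- equivalent to P and inherits property (P).
  have hdet : bracket ![ω ^ 2, 1, 1] ![ω, ω, 1] ![ω, 1, ω] ≠ 0 := by
    intro e
    simp [bracket] at e
    have : 3 * ω * (1 - ω) = 0 := by linear_combination e - ω * h3
    rcases mul_eq_zero.1 this with e | e
    · have : ω = 0 := by simpa using e
      simp [this] at hω
    · have : ω = 1 := by linear_combination -e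
      rw [this] at hω
      norm_num at hω
  have h' := (propertyP_map g).1 h
  have hP : PropertyP (pointSet fun i => g (ofRows _ _ _ hdet (stdTri ω i))) :=
    (propertyP_map g).2 ((propertyP_map _).2 h')
  rw [triplePoints_eq h (propertyP_pointSet_iff.1 hP).1]
  · exact hP
  · intro m
    simp only [through_map]
    fin_cases m
    · refine ⟨4, 5, by decide, fun k => ?_⟩
      rw [ofRows_apply]
      fin_cases k <;> simp [bracket, stdTri, syn, dotProduct, Fin.sum_univ_three] <;> grind
    · refine ⟨0, 1, by decide, fun k => ?_⟩
      rw [ofRows_apply]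
      fin_cases k <;> simp [bracket, stdTri, syn, dotProduct, Fin.sum_univ_three] <;> grind
    · refine ⟨1, 2, by decide, fun k => ?_⟩
      rw [ofRows_apply]
      fin_cases k <;> simp [bracket, stdTri, syn, dotProduct, Fin.sum_univ_three] <;> grind
    · refine ⟨3, 5, by decide, fun k => ?_⟩
      rw [ofRows_apply]
      fin_cases k <;> simp [bracket, stdTri, syn, dotProduct, Fin.sum_univ_three] <;> grind
    · refine ⟨3, 4, by decide, fun k => ?_⟩
      rw [ofRows_apply]
      fin_cases k <;> simp [bracket, stdTri, syn, dotProduct, Fin.sum_univ_three] <;> grind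
    · refine ⟨0, 2, by decide, fun k => ?_⟩
      rw [ofRows_apply]
      fin_cases k <;> simp [bracket, stdTri, syn, dotProduct, Fin.sum_univ_three] <;> grind

/-! ### Recovering the reference triangle -/

lemma isQuad_std {α β γ : ℂ} (hα : α ≠ 0) (hβ : β ≠ 0) (hγ : γ ≠ 0)
    (h1 : (α * β * γ) ^ 2 ≠ 1) : IsQuad (std α β γ) where
  genPos := genPos_std hα hβ hγ h1
  concurrent i j hi hj := by
    rw [concurrent_iff_joubert, joubert_std]
    fin_cases i <;> (try exact absurd hi (by decide)) <;> fin_cases j <;>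
      (try exact absurd hj (by decide)) <;> rfl
  not_concurrent := by
    rw [concurrent_iff_joubert, joubert_std]
    intro e
    simp only [Matrix.cons_val] at e
    have : 8 * (α * β * γ) = 0 := by linear_combination e
    simp [hα, hβ, hγ] at this

/-- The relabelings that permute the three pairs. -/
def pairLabel : Fin 6 → Fin 6 → Fin 6 :=
  ![![0, 1, 2, 3, 4, 5], ![0, 1, 4, 5, 2, 3], ![2, 3, 0, 1, 4, 5], ![2, 3, 4, 5, 0, 1],
    ![4, 5, 0, 1, 2, 3], ![4, 5, 2, 3, 0, 1]]

lemma pairLabel_injective : ∀ k, Function.Injective (pairLabel k) := by decide +kernel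

lemma exists_pairLabel : ∀ p : Fin 3 → Fin 3, Function.Injective p →
    ∃ k, ∀ m, p (pairOf (pairLabel k m)) = pairOf m := by
  decide +kernel

lemma pairLabel_syn : ∀ k, ∀ i j : Fin 6, i < 4 → j < 4 → ∃ i' j' : Fin 6, i' < 4 ∧ j' < 4 ∧
    ∀ m, pairLabel k (syn i j m) = syn i' j' (pairLabel k m) := by
  decide +kernel

lemma pairLabel_syn_four_five : ∀ k m, pairLabel k (syn 4 5 m) = syn 4 5 (pairLabel k m) := by
  decide

lemma IsQuad.comp_pairLabel {u : Fin 6 → Fin 3 → ℂ} (h : IsQuad u) (k : Fin 6) :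
    IsQuad fun m => u (pairLabel k m) := by
  have hb := Finite.injective_iff_bijective.1 (pairLabel_injective k)
  refine ⟨h.genPos.comp hb.1, fun i j hi hj => ?_, ?_⟩
  · obtain ⟨i', j', hi', hj', e⟩ := pairLabel_syn k i j hi hj
    rw [concurrent_comp hb.2 e]
    exact h.concurrent _ _ hi' hj'
  · rw [concurrent_comp hb.2 (pairLabel_syn_four_five k)]
    exact h.not_concurrent

lemma std_pairOf (α β γ : ℂ) (m : Fin 6) : std α β γ m (pairOf m) = 0 := by
  fin_cases m <;> rfl

lemma pairOf_eq_iff : ∀ i j, i ≠ j → pairOf i = pairOf j →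
    (i = 0 ∧ j = 1 ∨ i = 1 ∧ j = 0) ∨ (i = 2 ∧ j = 3 ∨ i = 3 ∧ j = 2) ∨
      (i = 4 ∧ j = 5 ∨ i = 5 ∧ j = 4) := by decide

/-- The relation satisfied by the lines through a point of a standard sextuple on the side `k`. -/
def sideRel (α β γ : ℂ) (l : Fin 3 → ℂ) : Fin 3 → Prop :=
  ![l 1 ^ 2 = α ^ 2 * l 2 ^ 2, l 2 ^ 2 = β ^ 2 * l 0 ^ 2, l 0 ^ 2 = γ ^ 2 * l 1 ^ 2]

/-- Squaring the incidence relation removes the sign that distinguishes the two points of a side. -/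
lemma sideRel_of_dot {α β γ : ℂ} {l : Fin 3 → ℂ} {m : Fin 6} (h : l ⬝ᵥ std α β γ m = 0) :
    sideRel α β γ l (pairOf m) := by
  rw [dotProduct, Fin.sum_univ_three] at h
  fin_cases m <;> simp [std] at h <;> simp [sideRel, pairOf]
  · linear_combination (l 1 - l 2 * α) * h
  · linear_combination (l 1 + l 2 * α) * h
  · linear_combination (l 2 - l 0 * β) * h
  · linear_combination (l 2 + l 0 * β) * h
  · linear_combination (l 0 - l 1 * γ) * h
  · linear_combination (l 0 + l 1 * γ) * h

lemma coordinate_of_dot_pair {α β γ : ℂ} (hα : α ≠ 0) (hβ : β ≠ 0) (hγ : γ ≠ 0) {l : Fin 3 → ℂ}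
    {i j : Fin 6} (hij : i ≠ j) (hp : pairOf i = pairOf j) (hi : l ⬝ᵥ std α β γ i = 0)
    (hj : l ⬝ᵥ std α β γ j = 0) : ∃ k, ∀ k', k' ≠ k → l k' = 0 := by
  have key : ∀ x y z : ℂ, z ≠ 0 → x + y * z = 0 → x + -(y * z) = 0 → x = 0 ∧ y = 0 := by
    intro x y z hz h1 h2
    have hx : x = 0 := by linear_combination (h1 + h2) / 2
    refine ⟨hx, ?_⟩
    rw [hx, zero_add] at h1
    exact (mul_eq_zero.1 h1).resolve_right hz
  rw [dotProduct, Fin.sum_univ_three] at hi hj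
  rcases pairOf_eq_iff i j hij hp with (⟨rfl, rfl⟩ | ⟨rfl, rfl⟩) | (⟨rfl, rfl⟩ | ⟨rfl, rfl⟩) |
    (⟨rfl, rfl⟩ | ⟨rfl, rfl⟩) <;> simp [std] at hi hj
  · have := key _ _ _ hα hi hj
    exact ⟨0, fun k' hk' => by fin_cases k' <;> simp_all⟩
  · have := key _ _ _ hα hj hi
    exact ⟨0, fun k' hk' => by fin_cases k' <;> simp_all⟩
  · have := key (l 2) (l 0) β hβ (by linear_combination hi) (by linear_combination hj)
    exact ⟨1, fun k' hk' => by fin_cases k' <;> simp_all⟩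
  · have := key (l 2) (l 0) β hβ (by linear_combination hj) (by linear_combination hi)
    exact ⟨1, fun k' hk' => by fin_cases k' <;> simp_all⟩
  · have := key _ _ _ hγ hi hj
    exact ⟨2, fun k' hk' => by fin_cases k' <;> simp_all⟩
  · have := key _ _ _ hγ hj hi
    exact ⟨2, fun k' hk' => by fin_cases k' <;> simp_all⟩

lemma exists_common_side : ∀ a b c d : Fin 3, a ≠ b → c ≠ d → a = c ∨ a = d ∨ b = c ∨ b = d := by
  decide

/-- A line meeting a side both in a point of the sextuple and in a triple point is that side,
because the two squared ratios differ when (αβγ)² ≠ 1. -/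
lemma coordinate_of_sideRel {α β γ : ℂ} (hα : α ≠ 0) (hβ : β ≠ 0) (hγ : γ ≠ 0)
    (h1 : (α * β * γ) ^ 2 ≠ 1) {l : Fin 3 → ℂ} {k : Fin 3} (h : sideRel α β γ l k)
    (h' : sideRel (β * γ)⁻¹ (α * γ)⁻¹ (α * β)⁻¹ l k) : ∃ k, ∀ k', k' ≠ k → l k' = 0 := by
  have key : ∀ x y a b c : ℂ, a ≠ 0 → b ≠ 0 → c ≠ 0 → (a * b * c) ^ 2 ≠ 1 →
      x ^ 2 = a ^ 2 * y ^ 2 → x ^ 2 = ((b * c)⁻¹) ^ 2 * y ^ 2 → x = 0 ∧ y = 0 := by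
    intro x y a b c ha hb hc h1 h2 h3
    have h4 : ((a * b * c) ^ 2 - 1) * y ^ 2 = 0 := by
      rw [h3] at h2
      field_simp at h2
      linear_combination -h2
    have hy : y = 0 := by
      simpa using (mul_eq_zero.1 h4).resolve_left (sub_ne_zero.2 h1)
    rw [hy] at h2
    exact ⟨by simpa using h2, hy⟩
  fin_cases k
  · have := key _ _ _ _ _ hα hβ hγ h1 h h'
    exact ⟨0, fun k' hk' => by fin_cases k' <;> simp_all⟩
  · have := key _ _ _ _ _ hβ hα hγ (by rwa [mul_comm β α]) h h'
    exact ⟨1, fun k' hk' => by fin_cases k' <;> simp_all⟩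
  · have := key _ _ _ _ _ hγ hα hβ (by rwa [mul_assoc, mul_comm γ]) h h'
    exact ⟨2, fun k' hk' => by fin_cases k' <;> simp_all⟩

/-- The only lines joining two points of a standard sextuple and two of its triple points are the
sides of the triangle of reference. -/
lemma coordinate_of_dots {α β γ : ℂ} (hα : α ≠ 0) (hβ : β ≠ 0) (hγ : γ ≠ 0)
    (h1 : (α * β * γ) ^ 2 ≠ 1) {l : Fin 3 → ℂ} {i j i' j' : Fin 6} (hij : i ≠ j) (hij' : i' ≠ j')
    (hi : l ⬝ᵥ std α β γ i = 0) (hj : l ⬝ᵥ std α β γ j = 0)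
    (hi' : l ⬝ᵥ std (β * γ)⁻¹ (α * γ)⁻¹ (α * β)⁻¹ i' = 0)
    (hj' : l ⬝ᵥ std (β * γ)⁻¹ (α * γ)⁻¹ (α * β)⁻¹ j' = 0) : ∃ k, ∀ k', k' ≠ k → l k' = 0 := by
  by_cases hp : pairOf i = pairOf j
  · exact coordinate_of_dot_pair hα hβ hγ hij hp hi hj
  by_cases hp' : pairOf i' = pairOf j'
  · exact coordinate_of_dot_pair (by simp [*]) (by simp [*]) (by simp [*]) hij' hp' hi' hj'
  have a := sideRel_of_dot hi
  have b := sideRel_of_dot hj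
  have c := sideRel_of_dot hi'
  have d := sideRel_of_dot hj'
  rcases exists_common_side _ _ _ _ hp hp' with e | e | e | e
  · exact coordinate_of_sideRel hα hβ hγ h1 a (e ▸ c)
  · exact coordinate_of_sideRel hα hβ hγ h1 a (e ▸ d)
  · exact coordinate_of_sideRel hα hβ hγ h1 b (e ▸ c)
  · exact coordinate_of_sideRel hα hβ hγ h1 b (e ▸ d)

lemma exists_pair_of_side : ∀ k, ∃ i j, i ≠ j ∧ pairOf i = k ∧ pairOf j = k := by decide

/-- A linear map carrying a standard sextuple and its triple points to a standard sextuple and its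
triple points permutes the sides of the triangle of reference. -/
lemma exists_perm_of_std {α β γ a b c : ℂ} (hα : α ≠ 0) (hβ : β ≠ 0) (hγ : γ ≠ 0)
    (h1 : (α * β * γ) ^ 2 ≠ 1) (M : (Fin 3 → ℂ) ≃ₗ[ℂ] (Fin 3 → ℂ))
    (h : ∃ (l : Equiv.Perm (Fin 6)) (r : Fin 6 → ℂ), (∀ i, r i ≠ 0) ∧
      ∀ i, M (std a b c i) = r i • std α β γ (l i))
    (h' : ∃ (l : Equiv.Perm (Fin 6)) (r : Fin 6 → ℂ), (∀ i, r i ≠ 0) ∧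
      ∀ i, M (std (b * c)⁻¹ (a * c)⁻¹ (a * b)⁻¹ i) =
        r i • std (β * γ)⁻¹ (α * γ)⁻¹ (α * β)⁻¹ (l i)) :
    ∃ p : Fin 3 → Fin 3, Function.Injective p ∧ ∀ x k, x k = 0 → M x (p k) = 0 := by
  obtain ⟨l, r, hr, e⟩ := h
  obtain ⟨l', r', hr', e'⟩ := h'
  -- L k is the image under M of the k-th side, as a linear form. It contains two points of the
  -- target sextuple and two of its triple points, so it is again a side.
  let L : Fin 3 → Fin 3 → ℂ := fun k j => M.symm (Pi.single j 1) k
  have hL : ∀ k y, L k ⬝ᵥ M y = y k := by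
    intro k y
    have hx : ∀ x : Fin 3 → ℂ, x = x 0 • Pi.single 0 1 + x 1 • Pi.single 1 1 +
        x 2 • Pi.single 2 1 := by
      intro x
      ext i
      fin_cases i <;> simp
    have h2 : y = M.symm (M y) := (M.symm_apply_apply y).symm
    rw [hx (M y)] at h2
    conv_rhs => rw [h2]
    simp only [map_add, map_smul, dotProduct, Fin.sum_univ_three, L, Pi.add_apply, Pi.smul_apply,
      smul_eq_mul]
    ring
  have hdot : ∀ k (y z : Fin 3 → ℂ) (t : ℂ), t ≠ 0 → M y = t • z → y k = 0 → L k ⬝ᵥ z = 0 := by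
    intro k y z t ht hM hy
    have := hL k y
    rw [hM, dotProduct_smul, hy, smul_eq_mul] at this
    exact (mul_eq_zero.1 this).resolve_left ht
  have hco : ∀ k, ∃ q, ∀ k', k' ≠ q → L k k' = 0 := by
    intro k
    obtain ⟨i, j, hij, hi, hj⟩ := exists_pair_of_side k
    refine coordinate_of_dots hα hβ hγ h1 (l.injective.ne hij) (l'.injective.ne hij)
      (hdot k _ _ _ (hr i) (e i) ?_) (hdot k _ _ _ (hr j) (e j) ?_)
      (hdot k _ _ _ (hr' i) (e' i) ?_) (hdot k _ _ _ (hr' j) (e' j) ?_)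
    · rw [← hi, std_pairOf]
    · rw [← hj, std_pairOf]
    · rw [← hi, std_pairOf]
    · rw [← hj, std_pairOf]
  choose p hp using hco
  have hsum : ∀ k x, L k (p k) * M x (p k) = x k := by
    intro k x
    rw [← hL k x, dotProduct, Finset.sum_eq_single (p k)]
    · intro j _ hj
      rw [hp k j hj, zero_mul]
    · simp
  have hne : ∀ k, L k (p k) ≠ 0 := by
    intro k h0
    have := hsum k (Pi.single k 1)
    simp [h0] at this
  refine ⟨p, fun k k' hk => ?_, fun x k hx => ?_⟩
  · by_contra hkk
    have h2 := hsum k (Pi.single k' 1)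
    have h3 := hsum k' (Pi.single k' 1)
    rw [Pi.single_eq_of_ne hkk] at h2
    have h4 := (mul_eq_zero.1 h2).resolve_left (hne k)
    rw [hk] at h4
    simp [h4] at h3
  · have := hsum k x
    rw [hx] at this
    exact (mul_eq_zero.1 this).resolve_left (hne k)

lemma exists_smul_std_of_pointSet_eq {u w : Fin 6 → Fin 3 → ℂ}
    (g h : (Fin 3 → ℂ) ≃ₗ[ℂ] (Fin 3 → ℂ)) (hu : GenPos u) (hw : GenPos w)
    (e : pointSet (fun i => h (u i)) = pointSet fun i => g (w i)) :
    ∃ (l : Equiv.Perm (Fin 6)) (r : Fin 6 → ℂ), (∀ i, r i ≠ 0) ∧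
      ∀ i, (h.trans g.symm) (u i) = r i • w (l i) := by
  obtain ⟨l, r, hr, h2⟩ := exists_smul_of_pointSet_eq ((genPos_map h u).2 hu)
    ((genPos_map g w).2 hw) e
  refine ⟨l, r, hr, fun i => ?_⟩
  rw [LinearEquiv.trans_apply, h2, map_smul, g.symm_apply_apply]

/-- In a fixed frame the vanishing coordinate tells which side a point is on, and the two points of
that side give the parameter up to sign. -/
lemma sq_eq_of_pointSet_std_eq {α β γ a b c : ℂ} (g : (Fin 3 → ℂ) ≃ₗ[ℂ] (Fin 3 → ℂ))
    (h1 : GenPos (std α β γ)) (h2 : GenPos (std a b c))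
    (e : pointSet (fun i => g (std α β γ i)) = pointSet fun i => g (std a b c i)) :
    α ^ 2 = a ^ 2 ∧ β ^ 2 = b ^ 2 ∧ γ ^ 2 = c ^ 2 := by
  obtain ⟨l, r, hr, h⟩ := exists_smul_std_of_pointSet_eq g g h1 h2 e
  have key : ∀ i k, std α β γ i k = r i * std a b c (l i) k := by
    intro i k
    have := congrFun (h i) k
    simpa using this
  refine ⟨?_, ?_, ?_⟩
  · have k0 := key 0 0
    have k1 := key 0 1
    have k2 := key 0 2
    have hr0 := hr 0
    generalize l 0 = m at k0 k1 k2
    generalize r 0 = t at k0 k1 k2 hr0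
    clear h key h1 h2 e
    fin_cases m <;> simp [std] at k0 k1 k2 <;> simp_all <;> rw [← k1, one_mul]
  · have k0 := key 2 0
    have k1 := key 2 1
    have k2 := key 2 2
    have hr0 := hr 2
    generalize l 2 = m at k0 k1 k2
    generalize r 2 = t at k0 k1 k2 hr0
    clear h key h1 h2 e
    fin_cases m <;> simp [std] at k0 k1 k2 <;> simp_all <;> rw [← k2, one_mul]
  · have k0 := key 4 0
    have k1 := key 4 1
    have k2 := key 4 2
    have hr0 := hr 4
    generalize l 4 = m at k0 k1 k2
    generalize r 4 = t at k0 k1 k2 hr0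
    clear h key h1 h2 e
    fin_cases m <;> simp [std] at k0 k1 k2 <;> simp_all <;> rw [← k0, one_mul]

lemma pointSet_std_eq_of_sq {α β γ a b c : ℂ} (h1 : α ^ 2 = a ^ 2) (h2 : β ^ 2 = b ^ 2)
    (h3 : γ ^ 2 = c ^ 2) : pointSet (std α β γ) = pointSet (std a b c) := by
  have n1 : ∀ x y z, pointSet (std (-x) y z) = pointSet (std x y z) := fun x y z => by
    rw [← pointSet_comp (u := std x y z) (l := Equiv.swap 0 1) (Equiv.surjective _)]
    congr 1
    ext i j
    fin_cases i <;> simp [std, Equiv.swap_apply_def]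
  have n2 : ∀ x y z, pointSet (std x (-y) z) = pointSet (std x y z) := fun x y z => by
    rw [← pointSet_comp (u := std x y z) (l := Equiv.swap 2 3) (Equiv.surjective _)]
    congr 1
    ext i j
    fin_cases i <;> simp [std, Equiv.swap_apply_def]
  have n3 : ∀ x y z, pointSet (std x y (-z)) = pointSet (std x y z) := fun x y z => by
    rw [← pointSet_comp (u := std x y z) (l := Equiv.swap 4 5) (Equiv.surjective _)]
    congr 1
    ext i j
    fin_cases i <;> simp [std, Equiv.swap_apply_def]
  rcases sq_eq_sq_iff_eq_or_eq_neg.1 h1 with rfl | rfl <;>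
    rcases sq_eq_sq_iff_eq_or_eq_neg.1 h2 with rfl | rfl <;>
    rcases sq_eq_sq_iff_eq_or_eq_neg.1 h3 with rfl | rfl <;> simp only [n1, n2, n3]

/-! ### Real configurations -/

lemma isReal_iff {x : Fin 3 → ℂ} (hx : x ≠ 0) :
    IsReal (toPoint x) ↔ ∃ y, conjVec y = y ∧ ∃ c : ℂ, c ≠ 0 ∧ x = c • y := by
  constructor
  · rintro ⟨v, hv, him, e⟩
    rw [← toPoint_of_ne hv, toPoint_eq_iff hx hv] at e
    obtain ⟨c, hc⟩ := e
    refine ⟨v, funext fun i => Complex.conj_eq_iff_im.2 (him i), c, ?_, hc.symm⟩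
    rintro rfl
    exact hx (by rw [← hc, zero_smul])
  · rintro ⟨y, hy, c, hc, e⟩
    have hy0 : y ≠ 0 := fun h => hx (by rw [e, h, smul_zero])
    refine ⟨y, hy0, fun i => Complex.conj_eq_iff_im.1 (congrFun hy i), ?_⟩
    rw [← toPoint_of_ne hy0, toPoint_eq_iff hx hy0]
    exact ⟨c, e.symm⟩

lemma PropertyP.exists_normalForm {P : Set Plane} (h : PropertyP P) :
    (∃ (g : (Fin 3 → ℂ) ≃ₗ[ℂ] (Fin 3 → ℂ)) (α β γ : ℂ), α ≠ 0 ∧ β ≠ 0 ∧ γ ≠ 0 ∧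
      P = pointSet fun i => g (std α β γ i)) ∨
    ∃ (g : (Fin 3 → ℂ) ≃ₗ[ℂ] (Fin 3 → ℂ)) (ω : ℂ), ω ^ 2 + ω + 1 = 0 ∧
      P = pointSet fun i => g (stdTri ω i) := by
  obtain ⟨u, rfl⟩ := exists_pointSet h.six_points
  obtain ⟨l, hl, hq | ht⟩ := exists_label h
  · obtain ⟨g, α, β, γ, hα, hβ, hγ, ⟨c, hc, e⟩, -⟩ := hq.exists_normalForm
    refine Or.inl ⟨g, α, β, γ, hα, hβ, hγ, ?_⟩
    rw [← pointSet_comp hl.2]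
    exact pointSet_eq_of_smul Function.surjective_id hc e
  · obtain ⟨g, ω, hω, ⟨c, hc, e⟩, -⟩ := ht.exists_normalForm
    refine Or.inr ⟨g, ω, hω, ?_⟩
    rw [← pointSet_comp hl.2]
    exact pointSet_eq_of_smul Function.surjective_id hc e

/-- A coordinate ratio of a real point is real; the coordinate equal to 1 fixes the scalar. -/
lemma conj_eq_of_isReal {g : (Fin 3 → ℂ) ≃ₗ[ℂ] (Fin 3 → ℂ)} (hg : IsRealEquiv g)
    {x : Fin 3 → ℂ} {i j : Fin 3} (hx : x j = 1) (h : IsReal (toPoint (g x))) :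
    starRingEnd ℂ (x i) = x i := by
  have hx0 : g x ≠ 0 := by
    intro e
    rw [g.map_eq_zero_iff.1 e] at hx
    exact zero_ne_one hx
  obtain ⟨y, hy, c, hc, e⟩ := (isReal_iff hx0).1 h
  have hz : conjVec (g.symm y) = g.symm y := by rw [hg.symm, hy]
  have hxz : x = c • g.symm y := by rw [← map_smul, ← e, g.symm_apply_apply]
  generalize g.symm y = z at hz hxz
  have zi : starRingEnd ℂ (z i) = z i := congrFun hz i
  have zj : starRingEnd ℂ (z j) = z j := congrFun hz j
  rw [hxz, Pi.smul_apply, smul_eq_mul] at hx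
  have hc' : starRingEnd ℂ c = c := by
    have hzj : z j ≠ 0 := right_ne_zero_of_mul_eq_one hx
    rw [eq_inv_of_mul_eq_one_left hx, map_inv₀, zj]
  rw [hxz, Pi.smul_apply, smul_eq_mul, map_mul, hc', zi]

lemma conj_eq_of_isReal_std {g : (Fin 3 → ℂ) ≃ₗ[ℂ] (Fin 3 → ℂ)} (hg : IsRealEquiv g) {α β γ : ℂ}
    (h : PropertyP (pointSet fun i => g (std α β γ i)))
    (hr : ∀ p ∈ pointSet fun i => g (std α β γ i), IsReal p) :
    starRingEnd ℂ α = α ∧ starRingEnd ℂ β = β ∧ starRingEnd ℂ γ = γ := by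
  have hR : ∀ i, IsReal (toPoint (g (std α β γ i))) := fun i => hr _ (by
    rw [pointSet_eq_range (propertyP_pointSet_iff.1 h).1.ne_zero]; exact ⟨i, rfl⟩)
  exact ⟨conj_eq_of_isReal (i := 2) (j := 1) hg (x := std α β γ 0) rfl (hR 0),
    conj_eq_of_isReal (i := 0) (j := 2) hg (x := std α β γ 2) rfl (hR 2),
    conj_eq_of_isReal (i := 1) (j := 0) hg (x := std α β γ 4) rfl (hR 4)⟩

/-- Real vectors give real frames. The second family is impossible, as ω would be a real primitive
cube root of unity. -/
lemma PropertyP.exists_real_normalForm {P : Set Plane} (h : PropertyP P)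
    (hr : ∀ p ∈ P, IsReal p) :
    ∃ (g : (Fin 3 → ℂ) ≃ₗ[ℂ] (Fin 3 → ℂ)) (α β γ : ℂ), α ≠ 0 ∧ β ≠ 0 ∧ γ ≠ 0 ∧
      P = (pointSet fun i => g (std α β γ i)) ∧ IsRealEquiv g ∧ starRingEnd ℂ α = α ∧
      starRingEnd ℂ β = β ∧ starRingEnd ℂ γ = γ := by
  obtain ⟨u, rfl⟩ := exists_pointSet h.six_points
  have hu := (propertyP_pointSet_iff.1 h).1.ne_zero
  have hw : ∀ i, ∃ y, conjVec y = y ∧ ∃ c : ℂ, c ≠ 0 ∧ u i = c • y := fun i =>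
    (isReal_iff (hu i)).1 (hr _ (by rw [pointSet_eq_range hu]; exact ⟨i, rfl⟩))
  choose w hw c hc e using hw
  have huw : pointSet u = pointSet w := pointSet_eq_of_smul Function.surjective_id hc e
  rw [huw] at h hr ⊢
  obtain ⟨l, hl, hq | ht⟩ := exists_label h
  · obtain ⟨g, α, β, γ, hα, hβ, hγ, ⟨c, hc, e⟩, hg⟩ := hq.exists_normalForm
    have hg := hg fun m => hw _
    have hP : pointSet w = pointSet fun i => g (std α β γ i) := by
      rw [← pointSet_comp hl.2]
      exact pointSet_eq_of_smul Function.surjective_id hc e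
    exact ⟨g, α, β, γ, hα, hβ, hγ, hP, hg, conj_eq_of_isReal_std hg (hP ▸ h) (hP ▸ hr)⟩
  · obtain ⟨g, ω, hω, -, hωr⟩ := ht.exists_normalForm
    exact (not_real_of_cube_root hω (hωr fun m => hw _)).elim

lemma isReal_of_std {g : (Fin 3 → ℂ) ≃ₗ[ℂ] (Fin 3 → ℂ)} (hg : IsRealEquiv g) {α β γ : ℂ}
    (hα : starRingEnd ℂ α = α) (hβ : starRingEnd ℂ β = β) (hγ : starRingEnd ℂ γ = γ) :
    ∀ p ∈ pointSet fun i => g (std α β γ i), IsReal p := by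
  rintro _ ⟨i, hi, rfl⟩
  rw [← toPoint_of_ne hi, isReal_iff hi]
  refine ⟨_, ?_, 1, one_ne_zero, (one_smul _ _).symm⟩
  rw [hg]
  congr 1
  ext j
  fin_cases i <;> fin_cases j <;> simp [conjVec, std, hα, hβ, hγ]

/-! ### The exceptional family and density -/

/-- The parameters of the configurations excluded from the generic statement. -/
def Exceptional (k : ℂ) : Prop :=
  k ^ 4 = -1 ∨ (k ^ 4 - 1) ^ 2 = 16 * k ^ 4 ∨ (k - 1) ^ 2 = 16 * k ∨ (k + 1) ^ 2 = -16 * k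

lemma finite_exceptional : {k | Exceptional k}.Finite := by
  open Polynomial in
  let p : ℂ[X] := (X ^ 4 + 1) * ((X ^ 4 - 1) ^ 2 - 16 * X ^ 4) * ((X - 1) ^ 2 - 16 * X) *
    ((X + 1) ^ 2 + 16 * X)
  have hp : p ≠ 0 := by
    intro h0
    have := congrArg (Polynomial.eval 0) h0
    simp [p] at this
  refine (Polynomial.finite_setOfPred_isRoot hp).subset fun k hk => ?_
  simp only [Set.mem_ofPred_eq, Polynomial.IsRoot, p, Polynomial.eval_mul, Polynomial.eval_add,
    Polynomial.eval_sub, Polynomial.eval_pow, Polynomial.eval_X, Polynomial.eval_one,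
    Polynomial.eval_ofNat, mul_eq_zero]
  rcases hk with h | h | h | h
  · exact Or.inl (Or.inl (Or.inl (by linear_combination h)))
  · exact Or.inl (Or.inl (Or.inr (by linear_combination h)))
  · exact Or.inl (Or.inr (by linear_combination h))
  · exact Or.inr (by linear_combination h)

/-- The exceptional family. -/
def exceptionalFamily : Set (Set Plane) :=
  (fun k => pointSet (std 1 1 k)) '' {k | Exceptional k}

/-- A diagonal map reduces the first two parameters to 1, so over ℂ only the product αβγ matters. -/
lemma projEquiv_std {α β γ : ℂ} (hα : α ≠ 0) (hβ : β ≠ 0)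
    (g : (Fin 3 → ℂ) ≃ₗ[ℂ] (Fin 3 → ℂ)) :
    ProjEquiv (pointSet (std 1 1 (α * β * γ))) (pointSet fun i => g (std α β γ i)) := by
  have hd : bracket ![α * β, 0, 0] ![0, 1, 0] ![0, 0, α] ≠ 0 := by
    simp [bracket, hα, hβ]
  refine ⟨(ofRows _ _ _ hd).trans g, ?_⟩
  rw [← pointSet_map]
  refine pointSet_eq_of_smul (l := id) Function.surjective_id
    (c := ![1, 1, α, α, α * β, α * β]) ?_ fun i => ?_
  · intro i
    fin_cases i <;> simp [hα, hβ]
  · rw [LinearEquiv.trans_apply, ← map_smul, ofRows_apply]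
    congr 1
    ext j
    fin_cases i <;> fin_cases j <;>
      simp [std, dotProduct, Fin.sum_univ_three]

lemma not_exceptional {P : Set Plane} (h : PropertyPOutside exceptionalFamily P)
    {g : (Fin 3 → ℂ) ≃ₗ[ℂ] (Fin 3 → ℂ)} {α β γ : ℂ} (hα : α ≠ 0) (hβ : β ≠ 0)
    (hP : P = pointSet fun i => g (std α β γ i)) : ¬ Exceptional (α * β * γ) := by
  intro hk
  apply h.2 _ ⟨_, hk, rfl⟩
  rw [hP]
  exact projEquiv_std hα hβ g

/-- The two products of brackets whose quotient is a projective invariant. -/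
def bracketProd (u : Fin 6 → Fin 3 → ℂ) : ℂ × ℂ :=
  (bracket (u 0) (u 1) (u 2) * bracket (u 3) (u 4) (u 5),
    bracket (u 0) (u 2) (u 4) * bracket (u 1) (u 3) (u 5))

/-- Both products use each of the six vectors exactly once, so the scalars and the determinant of g
enter them equally. -/
lemma bracketProd_cross {u w : Fin 6 → Fin 3 → ℂ} {c : Fin 6 → ℂ}
    (g : (Fin 3 → ℂ) ≃ₗ[ℂ] (Fin 3 → ℂ)) (h : ∀ i, u i = c i • g (w i)) :
    (bracketProd u).1 * (bracketProd w).2 = (bracketProd u).2 * (bracketProd w).1 := by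
  have hg : ∀ x y z, bracket (g x) (g y) (g z) = LinearMap.det g.toLinearMap * bracket x y z :=
    bracket_map g.toLinearMap
  simp only [bracketProd, h, bracket_smul, hg]
  ring

lemma bracketProd_std (α β γ : ℂ) :
    bracketProd (std α β γ) = (4 * (α * β * γ), 1 - (α * β * γ) ^ 2) := by
  simp only [bracketProd, Prod.mk.injEq]
  constructor <;> simp [bracket, std] <;> ring

/-- The parameters of the standard sextuples equivalent to an exceptional one belong to a finite
set. -/
lemma exists_finite_of_projEquiv : ∃ S : Set ℂ, S.Finite ∧
    ∀ (g : (Fin 3 → ℂ) ≃ₗ[ℂ] (Fin 3 → ℂ)) (α β γ : ℂ),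
      PropertyP (pointSet fun i => g (std α β γ i)) →
      ∀ Q ∈ exceptionalFamily, ProjEquiv Q (pointSet fun i => g (std α β γ i)) →
        α * β * γ ∈ S := by
  let T : ℂ → Equiv.Perm (Fin 6) → Set ℂ := fun k l =>
    {x | (bracketProd fun i => std 1 1 k (l i)).2 ≠ 0 ∧
      4 * x * (bracketProd fun i => std 1 1 k (l i)).2 =
        (1 - x ^ 2) * (bracketProd fun i => std 1 1 k (l i)).1}
  refine ⟨⋃ k ∈ {k | Exceptional k}, ⋃ l, T k l, ?_, ?_⟩
  · refine finite_exceptional.biUnion fun k _ => Set.finite_iUnion fun l => ?_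
    simp only [T]
    generalize bracketProd (fun i => std 1 1 k (l i)) = b
    by_cases hb : b.2 = 0
    · simp [hb]
    let p : Polynomial ℂ := Polynomial.C 4 * Polynomial.X * Polynomial.C b.2 -
      (1 - Polynomial.X ^ 2) * Polynomial.C b.1
    have hp : p ≠ 0 := by
      intro h0
      -- At 1 the second term vanishes, leaving 4 times a nonzero bracket product.
      have := congrArg (Polynomial.eval 1) h0
      simp [p, hb] at this
    refine (Polynomial.finite_setOfPred_isRoot hp).subset fun x hx => ?_
    simp only [Set.mem_ofPred_eq] at hx
    simp [Polynomial.IsRoot, p, hx.2]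
  · rintro g α β γ hP _ ⟨k, hk, rfl⟩ ⟨φ, hφ⟩
    simp only at hφ
    rw [← pointSet_map] at hφ
    have hQ := (propertyP_map φ).1 (hφ ▸ hP)
    have hG := (propertyP_pointSet_iff.1 hQ).1
    have hG' := (genPos_map g _).1 (propertyP_pointSet_iff.1 hP).1
    obtain ⟨l, c, hc, e⟩ := exists_smul_of_pointSet_eq ((genPos_map g _).2 hG')
      ((genPos_map φ _).2 hG) hφ.symm
    have h2 : ∀ i, std α β γ i = c i • (φ.trans g.symm) (std 1 1 k (l i)) := fun i => by
      rw [LinearEquiv.trans_apply, ← map_smul, ← e, g.symm_apply_apply]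
    have h3 := bracketProd_cross (φ.trans g.symm) (w := fun i => std 1 1 k (l i)) h2
    rw [bracketProd_std] at h3
    refine Set.mem_biUnion (x := k) hk (Set.mem_iUnion.2 ⟨l, ?_, h3⟩)
    exact mul_ne_zero (hG _ _ _ (by simp) (by simp) (by simp))
      (hG _ _ _ (by simp) (by simp) (by simp))

lemma finite_setOf_degenerate {α β γ : ℂ} (hα : α ≠ 0) (hβ : β ≠ 0) {S : Set ℂ} (hS : S.Finite) :
    {t : ℂ | α * β * (γ + t) = 0 ∨ (α * β * (γ + t)) ^ 2 = 1 ∨ (α * β * (γ + t)) ^ 2 = -1 ∨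
      ((α * β * (γ + t)) ^ 2 - 1) ^ 2 = 16 * (α * β * (γ + t)) ^ 2 ∨
        α * β * (γ + t) ∈ S}.Finite := by
  open Polynomial in
  let p : ℂ[X] := X * (X ^ 2 - 1) * (X ^ 2 + 1) * ((X ^ 2 - 1) ^ 2 - 16 * X ^ 2)
  have hp : p ≠ 0 := by
    intro h0
    have := congrArg (Polynomial.eval 2) h0
    norm_num [p] at this
  have hinj : Function.Injective fun t : ℂ => α * β * (γ + t) := by
    intro s t h
    simpa [hα, hβ] using h
  refine (((Polynomial.finite_setOfPred_isRoot hp).union hS).preimage hinj.injOn).subset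
    fun t ht => ?_
  simp only [Set.mem_preimage, Set.mem_union, Set.mem_ofPred_eq, Polynomial.IsRoot, p,
    Polynomial.eval_mul, Polynomial.eval_add, Polynomial.eval_sub, Polynomial.eval_pow,
    Polynomial.eval_X, Polynomial.eval_one, Polynomial.eval_ofNat, mul_eq_zero] at ht ⊢
  generalize α * β * (γ + t) = x at ht
  grind

lemma isNegligible_exceptionalFamily : IsNegligible exceptionalFamily where
  finite := finite_exceptional.image _
  dense := by
    intro v (hv : PropertyP (pointSet v))
    by_cases hE : ∀ Q ∈ exceptionalFamily, ¬ ProjEquiv Q (pointSet v)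
    · exact subset_closure ⟨hv, hE⟩
    push Not at hE
    obtain ⟨_, ⟨k, hk, rfl⟩, g, hg⟩ := hE
    simp only at hg
    rw [← pointSet_map] at hg
    have hQ := (propertyP_map g).1 (hg ▸ hv)
    have hG := (propertyP_pointSet_iff.1 hQ).1
    obtain ⟨σ, c, hc, e⟩ := exists_smul_of_pointSet_eq (propertyP_pointSet_iff.1 hv).1
      ((genPos_map g _).2 hG) hg.symm
    obtain ⟨S, hS, hSE⟩ := exists_finite_of_projEquiv
    -- A curve through v that changes only the modulus, keeping frame, labels and scalars. Finitely
    -- many t are bad, so small nonzero t approximate v by admissible sextuples.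
    let V : ℂ → Fin 6 → Fin 3 → ℂ := fun t m => c m • g (std 1 1 (k + t) (σ m))
    have hV0 : V 0 = v := by
      funext m
      simp only [V, add_zero, e]
    have hVP : ∀ t, pointSet (V t) = pointSet fun i => g (std 1 1 (k + t) i) := fun t =>
      pointSet_eq_of_smul σ.surjective (fun i => hc _) fun i => rfl
    have hcont : Continuous V := by
      have hstd : ∀ m, Continuous fun t => std 1 1 (k + t) m := by
        intro m
        refine continuous_pi fun i => ?_
        fin_cases m <;> fin_cases i <;> simp [std] <;> fun_prop
      have hg : Continuous g := g.toLinearMap.continuous_of_finiteDimensional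
      exact continuous_pi fun m => (continuous_const_smul (c m)).comp (hg.comp (hstd (σ m)))
    refine mem_closure_of_tendsto (b := nhdsWithin 0 {(0 : ℂ)}ᶜ) (f := V) ?_ ?_
    · conv => rhs; rw [← hV0]
      exact hcont.continuousAt.mono_left nhdsWithin_le_nhds
    · have hev := nhdsNE_le_cofinite (0 : ℂ)
        (finite_setOf_degenerate (γ := k) one_ne_zero one_ne_zero hS).compl_mem_cofinite
      filter_upwards [hev] with t ht
      simp only [Set.mem_compl_iff, Set.mem_ofPred_eq, not_or] at ht
      obtain ⟨h0, h1, h2, h3, h4⟩ := ht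
      have hkt : k + t ≠ 0 := right_ne_zero_of_mul h0
      have hP : PropertyP (pointSet fun i => g (std 1 1 (k + t) i)) :=
        (propertyP_map g).2 (propertyP_std one_ne_zero one_ne_zero hkt h1 h2 h3)
      refine ⟨?_, fun Q hQ hQP => h4 ?_⟩
      · rw [hVP]; exact hP
      · rw [hVP] at hQP
        exact hSE g _ _ _ hP Q hQ hQP

/-! ### Triple points of generic configurations and real preimages -/

lemma PropertyPOutside.triplePoints {P : Set Plane}
    (h : PropertyPOutside exceptionalFamily P) : PropertyP (triplePoints P) := by
  rcases h.1.exists_normalForm with ⟨g, α, β, γ, hα, hβ, hγ, hP⟩ | ⟨g, ω, hω, hP⟩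
  · have hk := not_exceptional h hα hβ hP
    have hPP := h.1
    rw [hP] at hPP ⊢
    have h' := (propertyP_map g).1 hPP
    have h1 := sq_ne_one_of_genPos_std (propertyP_pointSet_iff.1 h').1
    have h2 := sq_ne_neg_one_of_propertyP_std h'
    rw [triplePoints_std hα hβ hγ g hPP, propertyP_map]
    have hκ : α * β * γ ≠ 0 := mul_ne_zero (mul_ne_zero hα hβ) hγ
    have e := dual_prod α β γ hα hβ hγ
    generalize α * β * γ = κ at hk h1 h2 hκ e
    -- For the modulus κ⁻² the first condition follows from κ² ≠ ±1; the other two are the first two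
    -- exceptional conditions.
    refine propertyP_std (by simp [*]) (by simp [*]) (by simp [*]) ?_ ?_ ?_ <;> rw [e]
    · intro h3
      field_simp at h3
      rcases mul_eq_zero.1 (show (κ ^ 2 - 1) * (κ ^ 2 + 1) = 0 by linear_combination -h3)
        with h4 | h4
      · exact h1 (by linear_combination h4)
      · exact h2 (by linear_combination h4)
    · intro h3
      field_simp at h3
      exact hk (Or.inl (by linear_combination h3))
    · intro h3
      field_simp at h3
      exact hk (Or.inr (Or.inl (by linear_combination h3)))
  · have hPP := h.1
    rw [hP] at hPP ⊢
    exact propertyP_triplePoints_stdTri hω g hPP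

/-- The sign of a nonzero real number, and a square root of the inverse of its absolute value. -/
lemma exists_real_scale {κ : ℂ} (h0 : κ ≠ 0) (hr : starRingEnd ℂ κ = κ) :
    ∃ s ρ : ℂ, starRingEnd ℂ s = s ∧ starRingEnd ℂ ρ = ρ ∧ (s = 1 ∨ s = -1) ∧
      s * ρ ^ 2 * κ = 1 := by
  obtain ⟨k, rfl⟩ := Complex.conj_eq_iff_real.1 hr
  have hk : k ≠ 0 := by simpa using h0
  have key : ∀ x : ℝ, 0 < x → (((√x)⁻¹ : ℝ) : ℂ) ^ 2 * (x : ℂ) = 1 := by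
    intro x hx
    have : (√x)⁻¹ ^ 2 * x = 1 := by
      rw [inv_pow, Real.sq_sqrt hx.le, inv_mul_cancel₀ hx.ne']
    exact_mod_cast this
  rcases lt_or_gt_of_ne hk with h | h
  · refine ⟨-1, (((√(-k))⁻¹ : ℝ) : ℂ), by simp, Complex.conj_ofReal _, Or.inr rfl, ?_⟩
    have := key (-k) (by linarith)
    push_cast at this ⊢
    linear_combination this
  · refine ⟨1, (((√k)⁻¹ : ℝ) : ℂ), by simp, Complex.conj_ofReal _, Or.inl rfl, ?_⟩
    rw [one_mul]
    exact key k h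

lemma exists_real_preimage {P : Set Plane} (h : PropertyPOutside exceptionalFamily P)
    (hr : ∀ p ∈ P, IsReal p) :
    ∃ R : Set Plane, (∀ p ∈ R, IsReal p) ∧ PropertyP R ∧ SixPoints.triplePoints R = P := by
  obtain ⟨g, α, β, γ, hα, hβ, hγ, hP, hg, rα, rβ, rγ⟩ := h.1.exists_real_normalForm hr
  have hk := not_exceptional h hα hβ hP
  have hκ : α * β * γ ≠ 0 := mul_ne_zero (mul_ne_zero hα hβ) hγ
  obtain ⟨s, ρ, rs, rρ, hs, e⟩ := exists_real_scale hκ (by simp [rα, rβ, rγ])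
  have hs2 : s ^ 2 = 1 := by rcases hs with rfl | rfl <;> ring
  have hρ : ρ ≠ 0 := by
    rintro rfl
    simp at e
  have hs0 : s ≠ 0 := by
    rintro rfl
    simp at e
  have h1 : (α * β * γ) ^ 2 ≠ 1 := by
    have := h.1
    rw [hP, propertyP_map] at this
    exact sq_ne_one_of_genPos_std (propertyP_pointSet_iff.1 this).1
  -- The preimage has parameters ρsα, ρβ, ργ: by sρ²κ = 1 their modulus is ρ, and passing to triple
  -- points returns sα, β, γ, which defines P since the sign s is immaterial.
  have hprod : ρ * s * α * (ρ * β) * (ρ * γ) = ρ := by linear_combination ρ * e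
  have hR : PropertyP (pointSet fun i => g (std (ρ * s * α) (ρ * β) (ρ * γ) i)) := by
    rw [propertyP_map]
    -- Since ρ² = s/κ, the equation ρ² = 1 contradicts κ² ≠ 1, while ρ² = -1 fails for real ρ. The
    -- last condition is (s - κ)² ≠ 16sκ, which for s = ±1 negates the last two exceptional
    -- conditions.
    refine propertyP_std (by simp [*]) (by simp [*]) (by simp [*]) ?_ ?_ ?_ <;> rw [hprod]
    · intro h2
      rw [h2, mul_one] at e
      apply h1
      have : (s * (α * β * γ)) ^ 2 = 1 := by rw [e, one_pow]
      rwa [mul_pow, hs2, one_mul] at this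
    · intro h2
      obtain ⟨r, rfl⟩ := Complex.conj_eq_iff_real.1 rρ
      have : r ^ 2 = -1 := by exact_mod_cast h2
      nlinarith [sq_nonneg r]
    · intro h2
      generalize α * β * γ = κ at hk e
      have h3 : (s - κ) ^ 2 = 16 * s * κ := by
        have h4 : (ρ ^ 2 * s * κ - s * κ) ^ 2 = 16 * (ρ ^ 2 * s * κ) * (s * κ) := by
          linear_combination (s * κ) ^ 2 * h2
        have h5 : ρ ^ 2 * s * κ = 1 := by linear_combination e
        rw [h5] at h4
        linear_combination h4 + (1 - κ ^ 2) * hs2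
      apply hk
      rcases hs with rfl | rfl
      · exact Or.inr (Or.inr (Or.inl (by linear_combination h3)))
      · exact Or.inr (Or.inr (Or.inr (by linear_combination h3)))
  refine ⟨_, isReal_of_std hg (α := ρ * s * α) (β := ρ * β) (γ := ρ * γ) ?_ ?_ ?_, hR, ?_⟩
  · simp [rρ, rs, rα]
  · simp [rρ, rβ]
  · simp [rρ, rγ]
  · rw [triplePoints_std (by simp [*]) (by simp [*]) (by simp [*]) g hR, hP, pointSet_map,
      pointSet_map]
    congr 1
    have e1 : (ρ * β * (ρ * γ))⁻¹ = s * α := by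
      refine inv_eq_of_mul_eq_one_right ?_
      linear_combination e
    have e2 : (ρ * s * α * (ρ * γ))⁻¹ = β := by
      refine inv_eq_of_mul_eq_one_right ?_
      linear_combination e
    have e3 : (ρ * s * α * (ρ * β))⁻¹ = γ := by
      refine inv_eq_of_mul_eq_one_right ?_
      linear_combination e
    rw [e1, e2, e3]
    exact pointSet_std_eq_of_sq (by rw [mul_pow, hs2, one_mul]) rfl rfl

/-- Two of the equalities multiplied and divided by the third give α⁴ = a⁴. Reality is essential to
pass to squares, since over ℂ one could have α² = -a². -/
lemma sq_eq_of_dual_sq_eq {α β γ a b c : ℂ} (hα : α ≠ 0) (hβ : β ≠ 0) (hγ : γ ≠ 0)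
    (ra : starRingEnd ℂ a = a) (rα : starRingEnd ℂ α = α)
    (h1 : ((β * γ)⁻¹) ^ 2 = ((b * c)⁻¹) ^ 2) (h2 : ((α * γ)⁻¹) ^ 2 = ((a * c)⁻¹) ^ 2)
    (h3 : ((α * β)⁻¹) ^ 2 = ((a * b)⁻¹) ^ 2) : α ^ 2 = a ^ 2 := by
  rw [inv_pow, inv_pow, inv_inj] at h1 h2 h3
  have h4 : α ^ 4 = a ^ 4 := by
    refine mul_right_cancel₀ (pow_ne_zero 2 (mul_ne_zero hβ hγ)) ?_
    linear_combination (α * γ) ^ 2 * h3 + (a * b) ^ 2 * h2 - a ^ 4 * h1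
  obtain ⟨r, rfl⟩ := Complex.conj_eq_iff_real.1 rα
  obtain ⟨s, rfl⟩ := Complex.conj_eq_iff_real.1 ra
  have h5 : (r ^ 2) ^ 2 = (s ^ 2) ^ 2 := by
    rw [← pow_mul, ← pow_mul]
    exact_mod_cast h4
  have h6 := (pow_left_inj₀ (sq_nonneg r) (sq_nonneg s) two_ne_zero).1 h5
  exact_mod_cast h6

lemma real_preimage_unique {P R R' : Set Plane} (hP : PropertyP P)
    (hR : (∀ p ∈ R, IsReal p) ∧ PropertyP R ∧ triplePoints R = P)
    (hR' : (∀ p ∈ R', IsReal p) ∧ PropertyP R' ∧ triplePoints R' = P) : R' = R := by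
  obtain ⟨r1, p1, t1⟩ := hR
  obtain ⟨r2, p2, t2⟩ := hR'
  obtain ⟨g, α, β, γ, hα, hβ, hγ, rfl, hg, rα, rβ, rγ⟩ := p1.exists_real_normalForm r1
  obtain ⟨h, a, b, c, ha, hb, hc, rfl, -, -, -, -⟩ := p2.exists_real_normalForm r2
  rw [triplePoints_std hα hβ hγ g p1] at t1
  rw [triplePoints_std ha hb hc h p2] at t2
  have hP1 := hP
  have hP2 := hP
  rw [← t1] at hP1
  rw [← t2] at hP2
  -- The triple points of P, computed in both frames: the change of frame matches both P and P',
  -- hence permutes the sides of the reference triangle.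
  have tt : triplePoints (pointSet fun i => h (std (b * c)⁻¹ (a * c)⁻¹ (a * b)⁻¹ i)) =
      triplePoints (pointSet fun i => g (std (β * γ)⁻¹ (α * γ)⁻¹ (α * β)⁻¹ i)) := by
    rw [t1, t2]
  rw [triplePoints_std (by simp [*]) (by simp [*]) (by simp [*]) g hP1,
    triplePoints_std (by simp [*]) (by simp [*]) (by simp [*]) h hP2] at tt
  have d1 := genPos_std_dual hα hβ hγ p1
  have d2 := genPos_std_dual ha hb hc p2
  have dd1 := genPos_std_dual (by simp [*]) (by simp [*]) (by simp [*]) hP1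
  have dd2 := genPos_std_dual (by simp [*]) (by simp [*]) (by simp [*]) hP2
  obtain ⟨p, hp, hp0⟩ := exists_perm_of_std (by simp [*]) (by simp [*]) (by simp [*])
    (sq_ne_one_of_genPos_std d1) (h.trans g.symm)
    (exists_smul_std_of_pointSet_eq g h d2 d1 (t2.trans t1.symm))
    (exists_smul_std_of_pointSet_eq g h dd2 dd1 tt)
  obtain ⟨k, hk⟩ := exists_pairLabel p hp
  have hq := (isQuad_map (h.trans g.symm)).2 ((isQuad_std ha hb hc
    (sq_ne_one_of_genPos_std
      (propertyP_pointSet_iff.1 ((propertyP_map h).1 p2)).1)).comp_pairLabel k)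
  obtain ⟨a', b', c', ha', hb', hc', r, hr, e⟩ := hq.exists_std fun m => by
    rw [← hk m]
    exact hp0 _ _ (std_pairOf a b c _)
  -- After relabeling the pairs, R' is a standard sextuple in the frame g of R, so only the
  -- parameters remain to be compared.
  have hR' : (pointSet fun i => h (std a b c i)) = pointSet fun i => g (std a' b' c' i) := by
    rw [← pointSet_comp (Finite.injective_iff_bijective.1 (pairLabel_injective k)).2]
    refine pointSet_eq_of_smul Function.surjective_id hr fun i => ?_
    rw [← map_smul, id, ← e, LinearEquiv.trans_apply, g.apply_symm_apply]
  rw [triplePoints_std ha hb hc h p2 |>.symm, hR'] at t2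
  rw [hR'] at p2 r2 ⊢
  obtain ⟨ra, rb, rc⟩ := conj_eq_of_isReal_std hg p2 r2
  rw [triplePoints_std ha' hb' hc' g p2] at t2
  obtain ⟨s1, s2, s3⟩ := sq_eq_of_pointSet_std_eq g d1 (genPos_std_dual ha' hb' hc' p2)
    (t1.trans t2.symm)
  rw [pointSet_map, pointSet_map]
  congr 1
  refine (pointSet_std_eq_of_sq ?_ ?_ ?_).symm
  · exact sq_eq_of_dual_sq_eq hα hβ hγ ra rα s1 s2 s3
  · exact sq_eq_of_dual_sq_eq hβ hα hγ rb rβ s2 s1 (by rwa [mul_comm β, mul_comm b'])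
  · exact sq_eq_of_dual_sq_eq hγ hα hβ rc rγ s3 (by rwa [mul_comm γ, mul_comm c'])
      (by rwa [mul_comm γ, mul_comm c'])

end SixPoints

theorem theorem3 :
    ∃ E : Set (Set SixPoints.Plane), SixPoints.IsNegligible E ∧
      ∀ P : Set SixPoints.Plane, SixPoints.PropertyPOutside E P →
        SixPoints.PropertyP (SixPoints.triplePoints P) ∧
        ((∀ p ∈ P, SixPoints.IsReal p) →
          ∃! R : Set SixPoints.Plane, (∀ p ∈ R, SixPoints.IsReal p) ∧
            SixPoints.PropertyP R ∧ SixPoints.triplePoints R = P) := by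
  refine ⟨SixPoints.exceptionalFamily, SixPoints.isNegligible_exceptionalFamily, fun P hP =>
    ⟨hP.triplePoints, fun hr => ?_⟩⟩
  obtain ⟨R, hR⟩ := SixPoints.exists_real_preimage hP hr
  exact ⟨R, hR, fun R' hR' => SixPoints.real_preimage_unique hP.1 hR hR'⟩
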